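/- Let $q\equiv 3 \pmod 4$ be a prime power and $n=q+1$. Let $\mathbb P^1_q$ be the projective line over $\mathbb F_q$; choose a representative vector $\hat P\in\mathbb F_q^2\setminus\{0\}$ of every point $P$ and a lift $\hat g\in GL(2,q)$ of every $g\in PGL(2,q)$. Put $\chi(a)=1$ if $a\in\mathbb F_q$ is a square ($0$ included) and $\chi(a)=-1$ otherwise, and let $H_q=(\chi(\det(\hat P,\hat Q)))_{P,Q\in\mathbb P^1_q}$ be the Paley matrix. Its doubling $$DH_q=\begin{bmatrix}H_q&H_q\\-H_q^\top&H_q^\top\end{bmatrix}$$ is a skew Hadamard matrix of size $2n$. A *double Paley frame* is a configuration $\Phi$ of $2n$ vectors in $\mathbb C^{n}$ that is switching equivalent (i.e. equal up to a unitary transformation, reordering, and unimodular factors on the vectors) to one with Gram matrix $$I_{2n}+\frac1{\sqrt{2n-1}}\begin{bmatrix} i(H_q-I_n)&H_q\\ H_q^\top& i(H_q^\top-I_n)\end{bmatrix}.$$ For $g\in PGL(2,q)$ let $\Pi(g)$ be the monomial matrix on $\mathbb P^1_q$ whose $(gP,P)$ entry is $\chi(\lambda(g,P))$, where $\lambda(g,P)\,\hat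 g\hat P=\widehat{gP}$, and let $$D\Pi(g)=\begin{bmatrix}\Pi(g)&0\\0&\Pi(g)\end{bmatrix}\ (g\in PSL(2,q)),\qquad D\Pi(g)=\begin{bmatrix}0&-\Pi(g)\\\Pi(g)&0\end{bmatrix}\ (g\notin PSL(2,q)).$$ Let $a+b\sqrt{-1}$ be a generator of $\mathbb F_q(\sqrt{-1})^\times$, let $\alpha,\beta\in\mathbb F_q$ satisfy $\alpha^2+\beta^2=-1$, and let $\Delta\subset PGL(2,q)$ be the subgroup generated by the classes $m_1$ of $\begin{bmatrix}a&b\\-b&a\end{bmatrix}$ and $t_1$ of $\begin{bmatrix}\alpha&\beta\\\beta&-\alpha\end{bmatrix}$. A projective unitary representation is a map $\pi$ to a unitary group with $\pi(gh)=c_{g,h}\,\pi(g)\pi(h)$, $|c_{g,h}|=1$. It is *genuine projective* if there are no unitary $Q$, unimodular scalars $c_g$ and (strict) unitary representation $\rho$ with $Q\pi(g)Q^*=c_g\,\rho(g)$ for all $g$. Then: 1. $\Delta$ is a dihedral group of order $2(q+1)$, with rotation $m_1$ of order $q+1$ and reflection $t_1$. 2. $D\Pi$ is a projective unitary representation of $PGL(2,q)$,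 and $D\Pi|_\Delta$ is genuine projective. 3. Double Paley frames exist, and each of them is an $ETF(2q+2,q+1)$ of unit vectors. 4. Every double Paley frame $\Phi$ is a genuine projective dihedral frame through $D\Pi|_{\Delta}$: there are a configuration $\Phi_0$ switching equivalent to $\Phi$, with Gram matrix $I_{2n}+\frac{i}{\sqrt{2n-1}}(DH_q-I_{2n})$, and a genuine projective unitary representation $\pi$ of $\Delta$ on $\mathbb C^{n}$ with $\pi(g)\,\Phi_0\,D\Pi(g)^*=\Phi_0$ for all $g\in\Delta$, such that for each vector $v$ of $\Phi_0$ the configuration $(\pi(g)v)_{g\in\Delta}$ consists of pairwise non-proportional unit vectors and is switching equivalent to $\Phi$. -/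

import Mathlib

open scoped Matrix

/-! ### Configurations, frames, switching equivalence -/

/-- Two matrices are projectively equal: they differ by a unimodular scalar. -/
def ProjEq {m n : Type*} (A B : Matrix m n ℂ) : Prop :=
  ∃ c : ℂ, ‖c‖ = 1 ∧ A = c • B

/-- The columns of `Φ` are unit vectors. -/
def HasUnitColumns {m ι : Type*} [Fintype m] (Φ : Matrix m ι ℂ) : Prop :=
  ∀ j, ∑ i, ‖Φ i j‖ ^ 2 = 1

/-- The columns of `Φ` form a tight frame: the two frame bounds coincide. -/
def IsTightFrame {m ι : Type*} [Fintype m] [Fintype ι] (Φ : Matrix m ι ℂ) : Prop :=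
  ∃ A : ℝ, 0 < A ∧
    ∀ x : m → ℂ, ∑ j, ‖∑ i, star (Φ i j) * x i‖ ^ 2 = A * ∑ i, ‖x i‖ ^ 2

/-- An equiangular tight frame of unit vectors (the vectors are the columns of `Φ`). -/
def IsETF {m ι : Type*} [Fintype m] [Fintype ι] (Φ : Matrix m ι ℂ) : Prop :=
  HasUnitColumns Φ ∧ IsTightFrame Φ ∧
    ∃ c : ℝ, ∀ j k : ι, j ≠ k → ‖∑ i, star (Φ i j) * Φ i k‖ = c

/-- A configuration is reduced if its vectors are pairwise non-proportional. -/
def IsReducedConfig {m ι : Type*} (Φ : Matrix m ι ℂ) : Prop :=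
  ∀ j k : ι, j ≠ k → ∀ c : ℂ, (fun i => Φ i j) ≠ fun i => c * Φ i k

/-- Switching equivalence: `Ψ` arises from `Φ` by a unitary transformation, a reindexing of the
vectors and a change of the phases of the vectors. -/
def SwitchingEquiv {m ι κ : Type*} [Fintype m] [DecidableEq m]
    (Φ : Matrix m ι ℂ) (Ψ : Matrix m κ ℂ) : Prop :=
  ∃ (Q : Matrix m m ℂ) (σ : κ ≃ ι) (d : κ → ℂ), Q ∈ Matrix.unitaryGroup m ℂ ∧
    (∀ j, ‖d j‖ = 1) ∧ ∀ i j, Ψ i j = d j * (Q * Φ) i (σ j)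

/-! ### Projective unitary representations -/

/-- `π` is a projective unitary representation. -/
def IsProjUnitaryRep {G m : Type*} [Group G] [Fintype m] [DecidableEq m]
    (π : G → Matrix m m ℂ) : Prop :=
  (∀ g, π g ∈ Matrix.unitaryGroup m ℂ) ∧ ∀ g h, ProjEq (π (g * h)) (π g * π h)

/-- Equivalence of projective unitary representations. -/
def ProjRepEquiv {G m : Type*} [Fintype m] [DecidableEq m]
    (π π' : G → Matrix m m ℂ) : Prop :=
  ∃ Q ∈ Matrix.unitaryGroup m ℂ, ∀ g, ProjEq (Q * π g * Qᴴ) (π' g)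

/-- A genuine projective unitary representation: one that is not equivalent to a strict unitary
representation, i.e. to a homomorphism into the unitary group. -/
def IsGenuineProjRep {G m : Type*} [Group G] [Fintype m] [DecidableEq m]
    (π : G → Matrix m m ℂ) : Prop :=
  IsProjUnitaryRep π ∧
    ¬ ∃ ρ : G →* Matrix.unitaryGroup m ℂ, ProjRepEquiv π fun g => (ρ g : Matrix m m ℂ)

/-- The group configuration `(π(g) v)_g`, as a matrix with columns indexed by the group. -/
def groupConfig {G m : Type*} [Fintype m] (π : G → Matrix m m ℂ) (v : m → ℂ) : Matrix m G ℂ :=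
  Matrix.of fun i g => (π g *ᵥ v) i

/-! ### Skew Hadamard matrices and their Gram matrices -/

/-- `H` is a skew Hadamard matrix. -/
def IsSkewHadamard {ι : Type*} [Fintype ι] [DecidableEq ι] (H : Matrix ι ι ℂ) : Prop :=
  (∀ i j, H i j = 1 ∨ H i j = -1) ∧
    H * Hᵀ = (Fintype.card ι : ℂ) • (1 : Matrix ι ι ℂ) ∧ H + Hᵀ = (2 : ℂ) • (1 : Matrix ι ι ℂ)

/-- The matrix `I + (i / √(N - 1)) (H - I)` attached to `H` of size `N`. -/
noncomputable def skewGram {ι : Type*} [Fintype ι] [DecidableEq ι] (H : Matrix ι ι ℂ) :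
    Matrix ι ι ℂ :=
  1 + (Complex.I / (√((Fintype.card ι : ℝ) - 1) : ℂ)) • (H - 1)

/-- The matrix `M(H) = I + (1 / √(2n - 1)) [i(P - I), Q; Qᵀ, i(R - I)]` attached to
`H = [P, Q; -Qᵀ, R]` of size `2n`. -/
noncomputable def blockGram {ι : Type*} [Fintype ι] [DecidableEq ι]
    (H : Matrix (ι ⊕ ι) (ι ⊕ ι) ℂ) : Matrix (ι ⊕ ι) (ι ⊕ ι) ℂ :=
  1 + (1 / (√(2 * (Fintype.card ι : ℝ) - 1) : ℂ)) •
    Matrix.fromBlocks (Complex.I • (H.toBlocks₁₁ - 1)) H.toBlocks₁₂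
      H.toBlocks₁₂ᵀ (Complex.I • (H.toBlocks₂₂ - 1))

/-- The doubling `[H, H; -Hᵀ, Hᵀ]`. -/
def doubling {ι : Type*} (H : Matrix ι ι ℂ) : Matrix (ι ⊕ ι) (ι ⊕ ι) ℂ :=
  Matrix.fromBlocks H H (-Hᵀ) Hᵀ

/-! ### The projective line and the (double) Paley matrix -/

/-- The projective line over `F`. -/
abbrev ProjLine (F : Type*) [Field F] : Type _ := Projectivization F (Fin 2 → F)

noncomputable instance (F : Type*) [Field F] [Finite F] : Fintype (ProjLine F) :=
  Fintype.ofFinite _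

noncomputable instance (F : Type*) [Field F] : DecidableEq (ProjLine F) :=
  Classical.decEq _

/-- The group `PGL(2, F)`. -/
abbrev PGL2 (F : Type*) [Field F] : Type _ := Matrix.ProjGenLinGroup (Fin 2) F

/-- `PSL(2, F)` as a subgroup of `PGL(2, F)`. -/
def PSL2 (F : Type*) [Field F] : Subgroup (PGL2 F) :=
  (Matrix.SpecialLinearGroup.toPGL :
    Matrix.SpecialLinearGroup (Fin 2) F →* Matrix.ProjGenLinGroup (Fin 2) F).range

/-- The quadratic character with the convention that it takes the value `1` at `0`. -/
noncomputable def leg {F : Type*} [Field F] (a : F) : ℂ :=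
  open scoped Classical in if ∃ x : F, a = x ^ 2 then 1 else -1

/-- A choice of a representative vector for each point of the projective line. -/
structure PointLift (F : Type*) [Field F] where
  vec : ProjLine F → Fin 2 → F
  vec_ne_zero : ∀ P, vec P ≠ 0
  mk_vec : ∀ P, Projectivization.mk F (vec P) (vec_ne_zero P) = P

/-- The determinant form on `F²`. -/
def detForm {F : Type*} [Field F] (v w : Fin 2 → F) : F := v 0 * w 1 - v 1 * w 0

/-- The Paley matrix. -/
noncomputable def paley {F : Type*} [Field F] (s : PointLift F) :
    Matrix (ProjLine F) (ProjLine F) ℂ :=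
  Matrix.of fun P Q => leg (detForm (s.vec P) (s.vec Q))

/-- The double Paley matrix. -/
noncomputable def doublePaley {F : Type*} [Field F] (s : PointLift F) :
    Matrix (ProjLine F ⊕ ProjLine F) (ProjLine F ⊕ ProjLine F) ℂ :=
  doubling (paley s)

/-- `Φ` is a double Paley configuration: up to switching equivalence, its Gram matrix is the one
attached to the double Paley matrix. -/
def IsDoublePaleyConfig {F m ι : Type*} [Field F] [Finite F] [Fintype m] [DecidableEq m]
    (s : PointLift F) (Φ : Matrix m ι ℂ) : Prop :=
  ∃ Ψ : Matrix m (ProjLine F ⊕ ProjLine F) ℂ,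
    Ψᴴ * Ψ = blockGram (doublePaley s) ∧ SwitchingEquiv Φ Ψ

/-! ### The monomial representations -/

theorem PointLift.exists_scalar {F : Type*} [Field F] (s : PointLift F)
    (A : Matrix.GeneralLinearGroup (Fin 2) F) (P : ProjLine F) :
    ∃ c : F, c • ((A : Matrix (Fin 2) (Fin 2) F) *ᵥ s.vec P)
      = s.vec ((Matrix.ProjGenLinGroup.mk A : PGL2 F) • P) := by
  have h : (Matrix.ProjGenLinGroup.mk A : PGL2 F) • P =
      Projectivization.mk F (A • s.vec P) ((smul_ne_zero_iff_ne A).2 (s.vec_ne_zero P)) := by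
    conv_lhs => rw [← s.mk_vec P]
    rfl
  have h2 := (s.mk_vec ((Matrix.ProjGenLinGroup.mk A : PGL2 F) • P)).trans h
  rw [Projectivization.mk_eq_mk_iff'] at h2
  exact h2

/-- The scalar `lam` with `lam • (A P̂)` equal to the chosen representative of the image of `P`. -/
noncomputable def PointLift.lam {F : Type*} [Field F] (s : PointLift F)
    (A : Matrix.GeneralLinearGroup (Fin 2) F) (P : ProjLine F) : F :=
  (s.exists_scalar A P).choose

/-- The monomial matrix `Π(g) = S(g) D(g)`, for the choice `s` of representatives of the points and
the choice `lift` of representatives of the elements of `PGL(2, F)`. -/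
noncomputable def paleyRep {F : Type*} [Field F] (s : PointLift F)
    (lift : PGL2 F → Matrix.GeneralLinearGroup (Fin 2) F) (g : PGL2 F) :
    Matrix (ProjLine F) (ProjLine F) ℂ :=
  Matrix.of fun R P => if R = g • P then leg (s.lam (lift g) P) else 0

/-- The representation `DΠ` of `PGL(2, F)`. -/
noncomputable def doublePaleyRep {F : Type*} [Field F] (s : PointLift F)
    (lift : PGL2 F → Matrix.GeneralLinearGroup (Fin 2) F) (g : PGL2 F) :
    Matrix (ProjLine F ⊕ ProjLine F) (ProjLine F ⊕ ProjLine F) ℂ :=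
  open scoped Classical in
  if g ∈ PSL2 F then Matrix.fromBlocks (paleyRep s lift g) 0 0 (paleyRep s lift g)
  else Matrix.fromBlocks 0 (-paleyRep s lift g) (paleyRep s lift g) 0

/-! ### The dihedral subgroup of `PGL(2, F)` -/

/-- `F(√-1)` acting on itself: `a + b√-1` is sent to `[a, b; -b, a]`. -/
def mulMatrix (F : Type*) [Field F] :
    QuadraticAlgebra F (-1) 0 →* Matrix (Fin 2) (Fin 2) F where
  toFun z := !![z.re, z.im; -z.im, z.re]
  map_one' := by
    ext i j
    fin_cases i <;> fin_cases j <;>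
      simp [QuadraticAlgebra.re_one, QuadraticAlgebra.im_one]
  map_mul' z w := by
    ext i j
    fin_cases i <;> fin_cases j <;> simp [Matrix.mul_apply, Fin.sum_univ_two]
    all_goals ring

/-- The image in `PGL(2, F)` of a unit `a + b√-1`. -/
def rotElt {F : Type*} [Field F] (u : (QuadraticAlgebra F (-1) 0)ˣ) : PGL2 F :=
  Matrix.ProjGenLinGroup.mk (Units.map (mulMatrix F) u)

/-- The image in `PGL(2, F)` of the matrix `[α, β; β, -α]`, where `α² + β² = -1`. -/
noncomputable def reflElt {F : Type*} [Field F] (α β : F) (h : α ^ 2 + β ^ 2 = -1) : PGL2 F :=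
  Matrix.ProjGenLinGroup.mk
    (Matrix.GeneralLinearGroup.mkOfDetNeZero !![α, β; β, -α] (by
      have h1 : Matrix.det !![α, β; β, -α] = 1 := by
        rw [Matrix.det_fin_two_of]; linear_combination -h
      rw [h1]; exact one_ne_zero))

/-- The subgroup of `PGL(2, F)` generated by the two elements. -/
noncomputable def dihedralSubgroup {F : Type*} [Field F] (u : (QuadraticAlgebra F (-1) 0)ˣ)
    (α β : F) (h : α ^ 2 + β ^ 2 = -1) : Subgroup (PGL2 F) :=
  Subgroup.closure {rotElt u, reflElt α β h}

/-!
Write `H = 1 + C`, where `C` is the Paley conference matrix. It is skew, and distinct rows of it are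
orthogonal because the involution of the projective line fixing two given points negates every
summand of their inner product (`sum_qchar_detForm_mul`); hence `C² = -q`. The doubled matrix `DH`
is therefore skew Hadamard, and the matrix `S = 1 + (i / √(2n - 1)) (DH - 1)` satisfies `S² = 2S`
and has trace `2n`, i.e. it is twice a projection of rank `n`. A frame in dimension `n` with this
Gram matrix has frame operator `2` (`mul_conjTranspose_eq_two`), so it is tight, and it is
equiangular since all off-diagonal entries of `S` have the same modulus. The matrix defining double
Paley frames differs from `S` by the phase `i` on half of the vectors, and it is realized by an
explicit frame, because the square root of its upper left block is a linear polynomial in `C`.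

On matrices, rather than on their classes, the monomial matrices `Π` form a strict representation,
with scalars `c` acting by `χ(c)`. Moreover `Π(A)` commutes with `C` up to the sign `χ(det A)`,
which makes every `DΠ(g)` commute with `DH` (`doublePaleyRep_mul_doublePaley`), hence with `S`. So
`π(g) = ½ Φ DΠ(g) Φᴴ` is a projective representation with `π(g) Φ = Φ DΠ(g)`.

It is genuine because the classes of `w = [0, 1; -1, 0]` and of `t = [α, β; β, -α]` commute in
`PGL(2, q)`, while `wt = -tw` and `χ(-1) = -1` force their images to anticommute; for a strict
representation commuting elements have commuting images (`isGenuineProjRep_of_anticommute`).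

Finally, a rotation of the projective line has no fixed point, and neither has a reflection in
`PSL(2, q)`: its eigenvalues would be square roots of the negative of a square, and `-1` is not a
square. As the rotations are transitive, the rotation `m₁` has order `q + 1`. The dihedral group,
which permutes two copies of the line (elements outside `PSL(2, q)` exchanging them), has
trivial stabilizers and as many elements as there are points, so it acts simply transitively
(`bijective_doubleAct`), and each of its orbits on the vectors of the frame is, up to signs, the
whole frame.
-/

/-! ### The quadratic character -/

section QuadraticCharacter

theorem leg_zero {F : Type*} [Field F] : leg (0 : F) = 1 := by
  unfold leg
  rw [if_pos ⟨0, by simp⟩]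

variable {F : Type*} [Field F] [Fintype F]

/-- The quadratic character of a finite field with complex values; unlike `leg`, it vanishes at `0`
and is multiplicative everywhere. -/
noncomputable def qchar (a : F) : ℂ :=
  open scoped Classical in ((quadraticChar F a : ℤ) : ℂ)

theorem qchar_mul (a b : F) : qchar (a * b) = qchar a * qchar b := by
  simp only [qchar, map_mul, Int.cast_mul]

@[simp] theorem qchar_zero : qchar (0 : F) = 0 := by simp [qchar]

@[simp] theorem qchar_one : qchar (1 : F) = 1 := by simp [qchar]

theorem qchar_eq_one_or_neg_one {a : F} (ha : a ≠ 0) : qchar a = 1 ∨ qchar a = -1 := by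
  classical
  rcases quadraticChar_dichotomy ha with h | h
  · left; unfold qchar; convert congrArg (Int.cast : ℤ → ℂ) h; simp
  · right; unfold qchar; convert congrArg (Int.cast : ℤ → ℂ) h; simp

theorem qchar_mul_self {a : F} (ha : a ≠ 0) : qchar a * qchar a = 1 := by
  rcases qchar_eq_one_or_neg_one ha with h | h <;> simp [h]

@[simp] theorem star_qchar (a : F) : star (qchar a) = qchar a := by
  simp [qchar]

theorem norm_qchar {a : F} (ha : a ≠ 0) : ‖qchar a‖ = 1 := by
  rcases qchar_eq_one_or_neg_one ha with h | h <;> simp [h]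

theorem qchar_eq_one_iff {a : F} (ha : a ≠ 0) : qchar a = 1 ↔ IsSquare a := by
  classical
  rw [← quadraticChar_one_iff_isSquare ha]
  unfold qchar
  constructor
  · intro h
    have : quadraticChar F a = 1 := by
      convert (Int.cast_injective (α := ℂ) (h.trans Int.cast_one.symm))
    exact this
  · intro h
    convert congrArg (Int.cast : ℤ → ℂ) h; simp

theorem leg_eq_qchar {a : F} (ha : a ≠ 0) : leg a = qchar a := by
  classical
  have hsq : (∃ x : F, a = x ^ 2) ↔ IsSquare a :=
    exists_congr fun x => by rw [sq]
  unfold leg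
  split_ifs with h
  · exact ((qchar_eq_one_iff ha).2 (hsq.1 h)).symm
  · rcases qchar_eq_one_or_neg_one ha with h' | h'
    · exact absurd (hsq.2 ((qchar_eq_one_iff ha).1 h')) h
    · exact h'.symm

theorem not_isSquare_neg_one (h4 : Fintype.card F % 4 = 3) : ¬ IsSquare (-1 : F) := by
  rw [FiniteField.isSquare_neg_one_iff]; simpa using h4

theorem qchar_neg_one (h4 : Fintype.card F % 4 = 3) : qchar (-1 : F) = -1 :=
  (qchar_eq_one_or_neg_one (neg_ne_zero.2 one_ne_zero)).resolve_left fun h =>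
    not_isSquare_neg_one h4 ((qchar_eq_one_iff (neg_ne_zero.2 one_ne_zero)).1 h)

theorem qchar_neg (h4 : Fintype.card F % 4 = 3) (a : F) : qchar (-a) = -qchar a := by
  rw [← neg_one_mul, qchar_mul, qchar_neg_one h4, neg_one_mul]

end QuadraticCharacter

/-! ### The determinant form and point representatives -/

section DeterminantForm
variable {F : Type*} [Field F]

theorem detForm_self (v : Fin 2 → F) : detForm v v = 0 := by simp [detForm, mul_comm]

theorem detForm_swap (v w : Fin 2 → F) : detForm w v = -detForm v w := by
  simp only [detForm]; ring

theorem detForm_smul_smul (c d : F) (v w : Fin 2 → F) :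
    detForm (c • v) (d • w) = c * d * detForm v w := by
  simp only [detForm, Pi.smul_apply, smul_eq_mul]; ring

theorem detForm_mulVec (A : Matrix (Fin 2) (Fin 2) F) (v w : Fin 2 → F) :
    detForm (A *ᵥ v) (A *ᵥ w) = A.det * detForm v w := by
  simp only [detForm, Matrix.mulVec, dotProduct, Fin.sum_univ_two, Matrix.det_fin_two]; ring

theorem PointLift.detForm_eq_zero_iff (s : PointLift F) {P Q : ProjLine F} :
    detForm (s.vec P) (s.vec Q) = 0 ↔ P = Q := by
  constructor
  · intro h
    rw [← s.mk_vec P, ← s.mk_vec Q, Projectivization.mk_eq_mk_iff']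
    simp only [detForm, sub_eq_zero] at h
    by_cases h0 : s.vec Q 0 = 0
    · have h1 : s.vec Q 1 ≠ 0 := fun h1 => s.vec_ne_zero Q (by ext i; fin_cases i <;> simp [h0, h1])
      refine ⟨s.vec P 1 / s.vec Q 1, ?_⟩
      have h2 : s.vec P 0 = 0 := by simpa [h0, h1] using h
      ext i; fin_cases i
      · simp [h0, h2]
      · simp [h1]
    · refine ⟨s.vec P 0 / s.vec Q 0, ?_⟩
      ext i; fin_cases i
      · simp [h0]
      · simp only [Pi.smul_apply, smul_eq_mul, Fin.mk_one]
        field_simp; linear_combination h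
  · rintro rfl; exact detForm_self _

end DeterminantForm

section PointLift
variable {F : Type*} [Field F] (s : PointLift F)

theorem PointLift.lam_smul (A : GL (Fin 2) F) (P : ProjLine F) :
    s.lam A P • ((A : Matrix (Fin 2) (Fin 2) F) *ᵥ s.vec P)
      = s.vec ((Matrix.ProjGenLinGroup.mk A : PGL2 F) • P) :=
  (s.exists_scalar A P).choose_spec

theorem PointLift.lam_ne_zero (A : GL (Fin 2) F) (P : ProjLine F) : s.lam A P ≠ 0 := by
  intro h
  have := s.lam_smul A P
  rw [h, zero_smul] at this
  exact s.vec_ne_zero _ this.symm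

theorem PointLift.lam_eq {A : GL (Fin 2) F} {P : ProjLine F} {c : F}
    (h : c • ((A : Matrix (Fin 2) (Fin 2) F) *ᵥ s.vec P)
      = s.vec ((Matrix.ProjGenLinGroup.mk A : PGL2 F) • P)) : s.lam A P = c := by
  have h2 := (s.lam_smul A P).trans h.symm
  have h0 : (A : Matrix (Fin 2) (Fin 2) F) *ᵥ s.vec P ≠ 0 := by
    intro h0
    rw [h0, smul_zero] at h
    exact s.vec_ne_zero _ h.symm
  exact smul_left_injective F h0 h2

theorem PointLift.lam_mul (A B : GL (Fin 2) F) (P : ProjLine F) :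
    s.lam (A * B) P = s.lam A ((Matrix.ProjGenLinGroup.mk B : PGL2 F) • P) * s.lam B P := by
  apply s.lam_eq
  rw [map_mul, mul_smul (Matrix.ProjGenLinGroup.mk A), ← s.lam_smul A, ← s.lam_smul B,
    Matrix.mulVec_smul, smul_smul, Matrix.mulVec_mulVec, Units.val_mul]

theorem PointLift.lam_scalar (c : Fˣ) (P : ProjLine F) :
    s.lam (Matrix.GeneralLinearGroup.scalar (Fin 2) c) P = (c : F)⁻¹ := by
  apply s.lam_eq
  rw [Matrix.ProjGenLinGroup.mk_scalar, one_smul]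
  ext i
  simp [Matrix.GeneralLinearGroup.coe_scalar]

/-- A fixed point of the class of `A` is spanned by an eigenvector of `A`. -/
theorem PointLift.exists_eigenvalue {A : GL (Fin 2) F} {P : ProjLine F}
    (h : (Matrix.ProjGenLinGroup.mk A : PGL2 F) • P = P) :
    ∃ c : F, (A : Matrix (Fin 2) (Fin 2) F) *ᵥ s.vec P = c • s.vec P := by
  refine ⟨(s.lam A P)⁻¹, ?_⟩
  have h2 := s.lam_smul A P
  rw [h] at h2
  rw [← h2, smul_smul, inv_mul_cancel₀ (s.lam_ne_zero A P), one_smul, h2]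

end PointLift

/-! ### The Paley conference matrix -/

section ConferenceMatrix
variable {F : Type*} [Field F] [Fintype F] (s : PointLift F)

/-- The Paley conference matrix: the Paley matrix with its diagonal removed. -/
noncomputable def paleyConf : Matrix (ProjLine F) (ProjLine F) ℂ :=
  Matrix.of fun P Q => qchar (detForm (s.vec P) (s.vec Q))

theorem paley_eq : paley s = 1 + paleyConf s := by
  ext P Q
  rw [Matrix.add_apply]
  by_cases h : P = Q
  · subst h; simp [paley, paleyConf, detForm_self, leg_zero]
  · rw [Matrix.one_apply_ne h, zero_add]
    exact leg_eq_qchar fun h0 => h (s.detForm_eq_zero_iff.1 h0)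

theorem paleyConf_transpose (h4 : Fintype.card F % 4 = 3) : (paleyConf s)ᵀ = -paleyConf s := by
  ext P Q
  simp only [paleyConf, Matrix.transpose_apply, Matrix.of_apply, Matrix.neg_apply]
  rw [detForm_swap, qchar_neg h4]

theorem paleyConf_conjTranspose (h4 : Fintype.card F % 4 = 3) :
    (paleyConf s)ᴴ = -paleyConf s := by
  rw [← paleyConf_transpose s h4]
  ext P Q
  simp [paleyConf, Matrix.conjTranspose_apply]

theorem card_projLine : Fintype.card (ProjLine F) = Fintype.card F + 1 := by
  rw [← Nat.card_eq_fintype_card, ← Nat.card_eq_fintype_card,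
    Projectivization.card_of_finrank_two F (Fin 2 → F) (by simp)]

/-- Distinct rows of the Paley conference matrix are orthogonal: the involution of the line
fixing both points `P` and `P'` changes the sign of every summand. -/
theorem sum_qchar_detForm_mul (h4 : Fintype.card F % 4 = 3) {P P' : ProjLine F} (h : P ≠ P') :
    ∑ Q, qchar (detForm (s.vec P) (s.vec Q)) * qchar (detForm (s.vec P') (s.vec Q)) = 0 := by
  set p := s.vec P with hp
  set r := s.vec P' with hr
  set d := detForm p r with hd
  have hd0 : d ≠ 0 := fun h0 => h (s.detForm_eq_zero_iff.1 h0)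
  -- the matrix acts as `d` on `p` and as `-d` on `r`
  let M : Matrix (Fin 2) (Fin 2) F :=
    !![r 1 * p 0 + p 1 * r 0, -2 * p 0 * r 0; 2 * p 1 * r 1, -(r 0 * p 1 + p 0 * r 1)]
  have hM : M.det = -(d * d) := by
    simp only [M, Matrix.det_fin_two_of, hd, detForm]; ring
  let A := Matrix.GeneralLinearGroup.mkOfDetNeZero M
    (by rw [hM]; exact neg_ne_zero.2 (mul_ne_zero hd0 hd0))
  have hp' (w : Fin 2 → F) : detForm p (M *ᵥ w) = -d * detForm p w := by
    simp only [M, hd, detForm, Matrix.mulVec, dotProduct, Fin.sum_univ_two, Matrix.of_apply,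
      Matrix.cons_val', Matrix.cons_val_zero, Matrix.cons_val_one, Matrix.cons_val_fin_one]
    ring
  have hr' (w : Fin 2 → F) : detForm r (M *ᵥ w) = d * detForm r w := by
    simp only [M, hd, detForm, Matrix.mulVec, dotProduct, Fin.sum_univ_two, Matrix.of_apply,
      Matrix.cons_val', Matrix.cons_val_zero, Matrix.cons_val_one, Matrix.cons_val_fin_one]
    ring
  let f : ProjLine F → ℂ := fun Q => qchar (detForm p (s.vec Q)) * qchar (detForm r (s.vec Q))
  have hf (Q : ProjLine F) : f ((Matrix.ProjGenLinGroup.mk A : PGL2 F) • Q) = -f Q := by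
    have hl := s.lam_ne_zero A Q
    have hv : s.vec ((Matrix.ProjGenLinGroup.mk A : PGL2 F) • Q) = s.lam A Q • (M *ᵥ s.vec Q) :=
      (s.lam_smul A Q).symm
    have hs (v w : Fin 2 → F) (c : F) : detForm v (c • w) = c * detForm v w := by
      simpa using detForm_smul_smul 1 c v w
    simp only [f, hv, hs, hp', hr', qchar_mul, qchar_neg h4]
    linear_combination (-(qchar d * qchar d) * qchar (detForm p (s.vec Q))
      * qchar (detForm r (s.vec Q))) * qchar_mul_self hl
      - (qchar (detForm p (s.vec Q)) * qchar (detForm r (s.vec Q))) * qchar_mul_self hd0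
  have hsum : ∑ Q, f ((Matrix.ProjGenLinGroup.mk A : PGL2 F) • Q) = ∑ Q, f Q :=
    Equiv.sum_comp (MulAction.toPerm (Matrix.ProjGenLinGroup.mk A : PGL2 F)) f
  simp only [hf, Finset.sum_neg_distrib] at hsum
  change ∑ Q, f Q = 0
  exact self_eq_neg.1 hsum.symm

theorem paleyConf_mul_transpose (h4 : Fintype.card F % 4 = 3) :
    paleyConf s * (paleyConf s)ᵀ = (Fintype.card F : ℂ) • 1 := by
  ext P P'
  simp only [Matrix.mul_apply, Matrix.transpose_apply, paleyConf, Matrix.of_apply,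
    Matrix.smul_apply, smul_eq_mul]
  by_cases h : P = P'
  · subst h
    have hQ (Q : ProjLine F) : qchar (detForm (s.vec P) (s.vec Q)) *
        qchar (detForm (s.vec P) (s.vec Q)) = 1 - if Q = P then 1 else 0 := by
      split_ifs with h
      · subst h; simp [detForm_self]
      · rw [qchar_mul_self fun h0 => h (s.detForm_eq_zero_iff.1 h0).symm, sub_zero]
    simp [hQ, card_projLine]
  · rw [sum_qchar_detForm_mul s h4 h, Matrix.one_apply_ne h, mul_zero]

theorem paleyConf_mul_self (h4 : Fintype.card F % 4 = 3) :
    paleyConf s * paleyConf s = -((Fintype.card F : ℂ) • 1) := by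
  rw [← paleyConf_mul_transpose s h4, paleyConf_transpose s h4, mul_neg, neg_neg]

theorem paley_transpose (h4 : Fintype.card F % 4 = 3) : (paley s)ᵀ = 1 - paleyConf s := by
  rw [paley_eq, Matrix.transpose_add, Matrix.transpose_one, paleyConf_transpose s h4,
    sub_eq_add_neg]

end ConferenceMatrix

/-! ### The monomial representation on the projective line -/

section MonomialRepresentation
variable {F : Type*} [Field F] [Fintype F] (s : PointLift F)

/-- The signed permutation matrix on the projective line attached to a matrix `A`. Indexing by
`GL(2, F)` rather than by `PGL(2, F)` makes it an honest homomorphism. -/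
noncomputable def paleyMono (A : GL (Fin 2) F) : Matrix (ProjLine F) (ProjLine F) ℂ :=
  Matrix.of fun R P =>
    if R = (Matrix.ProjGenLinGroup.mk A : PGL2 F) • P then qchar (s.lam A P) else 0

theorem paleyMono_mul_apply (A : GL (Fin 2) F) {κ : Type*} (M : Matrix (ProjLine F) κ ℂ)
    (P : ProjLine F) (k : κ) :
    (paleyMono s A * M) ((Matrix.ProjGenLinGroup.mk A : PGL2 F) • P) k
      = qchar (s.lam A P) * M P k := by
  rw [Matrix.mul_apply, Finset.sum_eq_single P]
  · simp [paleyMono]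
  · intro Q _ hQ
    simp only [paleyMono, Matrix.of_apply]
    rw [if_neg fun h => hQ (smul_left_cancel _ h).symm, zero_mul]
  · simp

theorem mul_paleyMono_apply (A : GL (Fin 2) F) {κ : Type*} (M : Matrix κ (ProjLine F) ℂ)
    (k : κ) (P : ProjLine F) :
    (M * paleyMono s A) k P
      = M k ((Matrix.ProjGenLinGroup.mk A : PGL2 F) • P) * qchar (s.lam A P) := by
  simp [Matrix.mul_apply, paleyMono]

theorem paleyMono_mul (A B : GL (Fin 2) F) :
    paleyMono s (A * B) = paleyMono s A * paleyMono s B := by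
  ext R P
  rw [mul_paleyMono_apply]
  simp only [paleyMono, Matrix.of_apply, s.lam_mul, qchar_mul, map_mul,
    mul_smul (Matrix.ProjGenLinGroup.mk A), ite_mul, zero_mul]

theorem paleyMono_scalar (c : Fˣ) :
    paleyMono s (Matrix.GeneralLinearGroup.scalar (Fin 2) c) = qchar (c : F) • 1 := by
  have hc : qchar ((c : F)⁻¹) = qchar (c : F) := by
    have h1 := qchar_mul_self c.ne_zero
    have h2 : qchar (c : F) * qchar ((c : F)⁻¹) = 1 := by
      rw [← qchar_mul, mul_inv_cancel₀ c.ne_zero, qchar_one]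
    linear_combination qchar ((c : F)⁻¹) * (-h1) + qchar (c : F) * h2
  ext R P
  simp [paleyMono, s.lam_scalar, hc, Matrix.one_apply]

theorem paleyMono_mem_unitaryGroup (A : GL (Fin 2) F) :
    paleyMono s A ∈ Matrix.unitaryGroup (ProjLine F) ℂ := by
  rw [Matrix.mem_unitaryGroup_iff']
  ext P Q
  rw [mul_paleyMono_apply, Matrix.star_apply]
  by_cases h : P = Q
  · subst h
    simp [paleyMono, qchar_mul_self (s.lam_ne_zero A P)]
  · rw [Matrix.one_apply_ne h]
    simp [paleyMono, show Q ≠ P from Ne.symm h]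

theorem paleyMono_mul_paleyConf (A : GL (Fin 2) F) :
    paleyMono s A * paleyConf s
      = qchar (A : Matrix (Fin 2) (Fin 2) F).det • (paleyConf s * paleyMono s A) := by
  ext R Q
  obtain ⟨P, rfl⟩ := MulAction.surjective (Matrix.ProjGenLinGroup.mk A : PGL2 F) R
  have hP := qchar_mul_self (s.lam_ne_zero A P)
  have hQ := qchar_mul_self (s.lam_ne_zero A Q)
  have hA := qchar_mul_self (Matrix.GeneralLinearGroup.det A).ne_zero
  rw [Matrix.GeneralLinearGroup.val_det_apply] at hA
  rw [paleyMono_mul_apply, Matrix.smul_apply, mul_paleyMono_apply]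
  simp only [paleyConf, Matrix.of_apply, smul_eq_mul]
  rw [← s.lam_smul A P, ← s.lam_smul A Q, detForm_smul_smul, detForm_mulVec]
  simp only [qchar_mul]
  linear_combination (-qchar (s.lam A P) * qchar (detForm (s.vec P) (s.vec Q))) *
    (hQ * qchar (A : Matrix (Fin 2) (Fin 2) F).det ^ 2 + hA)

theorem paleyRep_eq (lift : PGL2 F → GL (Fin 2) F)
    (hlift : ∀ g, (Matrix.ProjGenLinGroup.mk (lift g) : PGL2 F) = g) (g : PGL2 F) :
    paleyRep s lift g = paleyMono s (lift g) := by
  ext R P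
  simp only [paleyRep, paleyMono, Matrix.of_apply, hlift, leg_eq_qchar (s.lam_ne_zero _ _)]

/-- An element of `PGL(2, F)` lies in `PSL(2, F)` exactly when its determinant, which is defined
up to squares, is a square. -/
theorem mk_mem_PSL2_iff (A : GL (Fin 2) F) :
    (Matrix.ProjGenLinGroup.mk A : PGL2 F) ∈ PSL2 F
      ↔ qchar (A : Matrix (Fin 2) (Fin 2) F).det = 1 := by
  have hA := (Matrix.GeneralLinearGroup.det A).ne_zero
  rw [Matrix.GeneralLinearGroup.val_det_apply] at hA
  rw [qchar_eq_one_iff hA]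
  constructor
  · rintro ⟨S, hS⟩
    obtain ⟨c, hc⟩ := Matrix.ProjGenLinGroup.mk_eq_mk_iff.1 (show
      Matrix.ProjGenLinGroup.mk (Matrix.SpecialLinearGroup.toGL S) = Matrix.ProjGenLinGroup.mk A
      from hS)
    refine ⟨c, ?_⟩
    rw [← hc]
    simp [Matrix.GeneralLinearGroup.coe_scalar, sq]
  · rintro ⟨d, hd⟩
    have hd0 : d ≠ 0 := by rintro rfl; simp at hd; exact hA hd
    refine ⟨⟨d⁻¹ • (A : Matrix (Fin 2) (Fin 2) F), ?_⟩, ?_⟩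
    · rw [Matrix.det_smul, hd]; simp; field_simp
    · change Matrix.ProjGenLinGroup.mk (Matrix.SpecialLinearGroup.toGL _) = _
      rw [Matrix.ProjGenLinGroup.mk_eq_mk_iff]
      refine ⟨Units.mk0 d hd0, Units.ext ?_⟩
      have h1 : (d⁻¹ • (A : Matrix (Fin 2) (Fin 2) F)) * Matrix.scalar (Fin 2) d = A := by
        rw [Matrix.scalar_apply, ← Matrix.smul_one_eq_diagonal, Matrix.mul_smul, Matrix.mul_one,
          smul_smul, mul_inv_cancel₀ hd0, one_smul]
      exact h1

theorem mul_mem_PSL2_iff (g h : PGL2 F) : g * h ∈ PSL2 F ↔ (g ∈ PSL2 F ↔ h ∈ PSL2 F) := by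
  obtain ⟨A, rfl⟩ := Matrix.ProjGenLinGroup.mk_surjective g
  obtain ⟨B, rfl⟩ := Matrix.ProjGenLinGroup.mk_surjective h
  have hA := (Matrix.GeneralLinearGroup.det A).ne_zero
  have hB := (Matrix.GeneralLinearGroup.det B).ne_zero
  rw [Matrix.GeneralLinearGroup.val_det_apply] at hA hB
  rw [← map_mul, mk_mem_PSL2_iff, mk_mem_PSL2_iff, mk_mem_PSL2_iff, Units.val_mul, Matrix.det_mul,
    qchar_mul]
  have h1 : (-1 : ℂ) ≠ 1 := by norm_num
  rcases qchar_eq_one_or_neg_one hA with h | h <;>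
    rcases qchar_eq_one_or_neg_one hB with h' | h' <;> simp [h, h', h1]

theorem qchar_det_of_notMem_PSL2 {A : GL (Fin 2) F}
    (h : (Matrix.ProjGenLinGroup.mk A : PGL2 F) ∉ PSL2 F) :
    qchar (A : Matrix (Fin 2) (Fin 2) F).det = -1 := by
  have hA := (Matrix.GeneralLinearGroup.det A).ne_zero
  rw [Matrix.GeneralLinearGroup.val_det_apply] at hA
  exact (qchar_eq_one_or_neg_one hA).resolve_left fun h1 => h ((mk_mem_PSL2_iff A).2 h1)

end MonomialRepresentation

/-! ### The representation on two copies of the projective line -/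

section DoublePaleyRepresentation
variable {F : Type*} [Field F] [Fintype F] (s : PointLift F) {lift : PGL2 F → GL (Fin 2) F}
  (hlift : ∀ g, (Matrix.ProjGenLinGroup.mk (lift g) : PGL2 F) = g)
include hlift

theorem doublePaleyRep_of_mem {g : PGL2 F} (hg : g ∈ PSL2 F) :
    doublePaleyRep s lift g
      = Matrix.fromBlocks (paleyMono s (lift g)) 0 0 (paleyMono s (lift g)) := by
  rw [doublePaleyRep, if_pos hg, paleyRep_eq s lift hlift]

theorem doublePaleyRep_of_notMem {g : PGL2 F} (hg : g ∉ PSL2 F) :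
    doublePaleyRep s lift g
      = Matrix.fromBlocks 0 (-paleyMono s (lift g)) (paleyMono s (lift g)) 0 := by
  rw [doublePaleyRep, if_neg hg, paleyRep_eq s lift hlift]

theorem doublePaleyRep_mem_unitaryGroup (g : PGL2 F) :
    doublePaleyRep s lift g ∈ Matrix.unitaryGroup (ProjLine F ⊕ ProjLine F) ℂ := by
  have h := Matrix.mem_unitaryGroup_iff'.1 (paleyMono_mem_unitaryGroup s (lift g))
  rw [Matrix.star_eq_conjTranspose] at h
  rw [Matrix.mem_unitaryGroup_iff', Matrix.star_eq_conjTranspose]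
  by_cases hg : g ∈ PSL2 F
  · simp [doublePaleyRep_of_mem s hlift hg, Matrix.fromBlocks_conjTranspose,
      Matrix.fromBlocks_multiply, h]
  · simp [doublePaleyRep_of_notMem s hlift hg, Matrix.fromBlocks_conjTranspose,
      Matrix.fromBlocks_multiply, h]

theorem doublePaleyRep_mul (g h : PGL2 F) :
    ProjEq (doublePaleyRep s lift (g * h)) (doublePaleyRep s lift g * doublePaleyRep s lift h) := by
  obtain ⟨c, hc⟩ := Matrix.ProjGenLinGroup.mk_eq_mk_iff.1
    (show Matrix.ProjGenLinGroup.mk (lift g * lift h) = Matrix.ProjGenLinGroup.mk (lift (g * h)) by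
      rw [map_mul, hlift, hlift, hlift])
  have hM : paleyMono s (lift (g * h))
      = qchar (c : F) • (paleyMono s (lift g) * paleyMono s (lift h)) := by
    rw [← hc, paleyMono_mul, paleyMono_mul, paleyMono_scalar, Matrix.mul_smul, Matrix.mul_one]
  have hn := norm_qchar c.ne_zero
  have hmem := mul_mem_PSL2_iff g h
  by_cases hg : g ∈ PSL2 F <;> by_cases hh : h ∈ PSL2 F
  · refine ⟨qchar (c : F), hn, ?_⟩
    rw [doublePaleyRep_of_mem s hlift (hmem.2 (by tauto)), doublePaleyRep_of_mem s hlift hg,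
      doublePaleyRep_of_mem s hlift hh]
    simp [Matrix.fromBlocks_multiply, Matrix.fromBlocks_smul, hM]
  · refine ⟨qchar (c : F), hn, ?_⟩
    rw [doublePaleyRep_of_notMem s hlift (by tauto), doublePaleyRep_of_mem s hlift hg,
      doublePaleyRep_of_notMem s hlift hh]
    simp [Matrix.fromBlocks_multiply, Matrix.fromBlocks_smul, hM]
  · refine ⟨qchar (c : F), hn, ?_⟩
    rw [doublePaleyRep_of_notMem s hlift (by tauto), doublePaleyRep_of_notMem s hlift hg,
      doublePaleyRep_of_mem s hlift hh]
    simp [Matrix.fromBlocks_multiply, Matrix.fromBlocks_smul, hM]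
  · refine ⟨-qchar (c : F), by rwa [norm_neg], ?_⟩
    rw [doublePaleyRep_of_mem s hlift (hmem.2 (by tauto)), doublePaleyRep_of_notMem s hlift hg,
      doublePaleyRep_of_notMem s hlift hh]
    simp [Matrix.fromBlocks_multiply, Matrix.fromBlocks_smul, Matrix.fromBlocks_neg, hM]

theorem isProjUnitaryRep_doublePaleyRep : IsProjUnitaryRep (doublePaleyRep s lift) :=
  ⟨doublePaleyRep_mem_unitaryGroup s hlift, doublePaleyRep_mul s hlift⟩

/-- The elements of `PGL(2, F)` act by signed automorphisms of the double Paley matrix: elements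
outside `PSL(2, F)` transpose the Paley matrix, which the exchange of the blocks compensates. -/
theorem doublePaleyRep_mul_doublePaley (h4 : Fintype.card F % 4 = 3) (g : PGL2 F) :
    doublePaleyRep s lift g * doublePaley s = doublePaley s * doublePaleyRep s lift g := by
  have hC := paleyMono_mul_paleyConf s (lift g)
  rw [doublePaley, doubling, paley_transpose s h4, paley_eq]
  by_cases hg : g ∈ PSL2 F
  · rw [(mk_mem_PSL2_iff (lift g)).1 (by rwa [hlift]), one_smul] at hC
    rw [doublePaleyRep_of_mem s hlift hg]
    simp [Matrix.fromBlocks_multiply, Matrix.mul_add, Matrix.add_mul, Matrix.mul_sub,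
      Matrix.sub_mul, hC]
  · rw [qchar_det_of_notMem_PSL2 (by rwa [hlift]), neg_one_smul] at hC
    rw [doublePaleyRep_of_notMem s hlift hg]
    simp [Matrix.fromBlocks_multiply, Matrix.mul_add, Matrix.add_mul, hC, sub_eq_add_neg,
      add_comm]

/-- Matrices that anticommute have anticommuting images, since `-1` is not a square. -/
theorem doublePaleyRep_anticommute (h4 : Fintype.card F % 4 = 3) {A B : GL (Fin 2) F}
    (hAB : (A : Matrix (Fin 2) (Fin 2) F) * B = -((B : Matrix (Fin 2) (Fin 2) F) * A))
    (hA : (Matrix.ProjGenLinGroup.mk A : PGL2 F) ∈ PSL2 F)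
    (hB : (Matrix.ProjGenLinGroup.mk B : PGL2 F) ∈ PSL2 F) :
    doublePaleyRep s lift (Matrix.ProjGenLinGroup.mk A)
        * doublePaleyRep s lift (Matrix.ProjGenLinGroup.mk B)
      = -(doublePaleyRep s lift (Matrix.ProjGenLinGroup.mk B)
        * doublePaleyRep s lift (Matrix.ProjGenLinGroup.mk A)) := by
  have hlift' (X : GL (Fin 2) F) : ∃ c : ℂ,
      paleyMono s (lift (Matrix.ProjGenLinGroup.mk X)) = c • paleyMono s X := by
    obtain ⟨c, hc⟩ := Matrix.ProjGenLinGroup.mk_eq_mk_iff.1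
      (hlift (Matrix.ProjGenLinGroup.mk X)).symm
    exact ⟨qchar (c : F), by rw [← hc, paleyMono_mul, paleyMono_scalar]; simp⟩
  have h1 : A * B = B * A * Matrix.GeneralLinearGroup.scalar (Fin 2) (-1) := by
    apply Units.ext
    simp [hAB, ← Matrix.smul_one_eq_diagonal]
  have h2 : paleyMono s A * paleyMono s B = -(paleyMono s B * paleyMono s A) := by
    rw [← paleyMono_mul, h1, paleyMono_mul, paleyMono_scalar, paleyMono_mul]
    simp [qchar_neg_one h4]
  obtain ⟨a, ha⟩ := hlift' A
  obtain ⟨b, hb⟩ := hlift' B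
  rw [doublePaleyRep_of_mem s hlift hA, doublePaleyRep_of_mem s hlift hB, ha, hb]
  simp [Matrix.fromBlocks_multiply, h2, Matrix.fromBlocks_neg, smul_comm a b]

end DoublePaleyRepresentation

/-! ### The double Paley matrix is skew Hadamard -/

section DoublePaleyMatrix
variable {F : Type*} [Field F] [Fintype F] (s : PointLift F)

theorem isSkewHadamard_doublePaley (h4 : Fintype.card F % 4 = 3) :
    IsSkewHadamard (doublePaley s) := by
  have hT := paley_transpose s h4
  have hC := paleyConf_mul_self s h4
  refine ⟨?_, ?_, ?_⟩
  · have hl (P Q : ProjLine F) : paley s P Q = 1 ∨ paley s P Q = -1 := by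
      simp only [paley, leg, Matrix.of_apply]
      split_ifs <;> simp
    rintro (P | P) (Q | Q)
    · exact hl P Q
    · exact hl P Q
    · rcases hl Q P with h | h <;> simp [doublePaley, doubling, h]
    · exact hl Q P
  · simp only [doublePaley, doubling, Matrix.fromBlocks_transpose, Matrix.fromBlocks_multiply,
      Matrix.transpose_neg, Matrix.transpose_transpose, Fintype.card_sum, card_projLine]
    rw [hT, paley_eq, ← Matrix.fromBlocks_one, Matrix.fromBlocks_smul]
    congr 1
    · simp only [Matrix.mul_sub, Matrix.add_mul, Matrix.mul_one, Matrix.one_mul, hC]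
      push_cast; module
    · simp only [Matrix.mul_add, Matrix.add_mul, Matrix.mul_one, Matrix.one_mul, mul_neg, smul_zero]
      abel
    · simp only [Matrix.mul_sub, Matrix.sub_mul, Matrix.mul_one, Matrix.one_mul, neg_mul, smul_zero]
      abel
    · simp only [Matrix.mul_add, Matrix.sub_mul, Matrix.mul_one, Matrix.one_mul, hC, neg_mul,
        mul_neg]
      push_cast; module
  · simp only [doublePaley, doubling, Matrix.fromBlocks_transpose, Matrix.fromBlocks_add,
      Matrix.transpose_neg, Matrix.transpose_transpose]
    rw [hT, paley_eq, ← Matrix.fromBlocks_one, Matrix.fromBlocks_smul]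
    congr 1
    · module
    · simp
    · simp
    · module

end DoublePaleyMatrix

/-! ### Gram matrices and switching equivalence -/

section GramMatrices
variable {m ι κ : Type*} [Fintype m]

theorem hasUnitColumns_iff {Φ : Matrix m ι ℂ} : HasUnitColumns Φ ↔ ∀ j, (Φᴴ * Φ) j j = 1 := by
  refine forall_congr' fun j => ?_
  have h : (Φᴴ * Φ) j j = ((∑ i, ‖Φ i j‖ ^ 2 : ℝ) : ℂ) := by
    simp [Matrix.mul_apply, Matrix.conjTranspose_apply, Complex.conj_mul']
  rw [h, Complex.ofReal_eq_one]

/-- Unit vectors whose pairwise inner products have modulus less than one are pairwise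
non-proportional. -/
theorem isReducedConfig_of_norm_lt {Φ : Matrix m ι ℂ} (h1 : ∀ j, (Φᴴ * Φ) j j = 1)
    (h2 : ∀ j k, j ≠ k → ‖(Φᴴ * Φ) j k‖ < 1) : IsReducedConfig Φ := by
  intro j k hjk c hc
  have hc' (i : m) : Φ i j = c * Φ i k := congrFun hc i
  have hjk' : (Φᴴ * Φ) k j = c * (Φᴴ * Φ) k k := by
    rw [Matrix.mul_apply, Matrix.mul_apply, Finset.mul_sum]
    exact Finset.sum_congr rfl fun i _ => by rw [hc']; ring
  have hjj : (Φᴴ * Φ) j j = star c * (Φᴴ * Φ) k j := by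
    rw [Matrix.mul_apply, Matrix.mul_apply, Finset.mul_sum]
    refine Finset.sum_congr rfl fun i _ => ?_
    rw [Matrix.conjTranspose_apply, Matrix.conjTranspose_apply, hc', star_mul]; ring
  have hlt := h2 k j (Ne.symm hjk)
  rw [hjk', h1, mul_one] at hlt
  rw [hjk', h1, h1, mul_one] at hjj
  have hn := congrArg norm hjj
  rw [norm_one, norm_mul, norm_star] at hn
  nlinarith [norm_nonneg c]

variable [DecidableEq m]

theorem gram_apply_of_switching {Φ : Matrix m ι ℂ} {Ψ : Matrix m κ ℂ} {Q : Matrix m m ℂ}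
    {σ : κ → ι} {d : κ → ℂ} (hQ : Q ∈ Matrix.unitaryGroup m ℂ)
    (h : ∀ i j, Ψ i j = d j * (Q * Φ) i (σ j)) (j k : κ) :
    (Ψᴴ * Ψ) j k = star (d j) * d k * (Φᴴ * Φ) (σ j) (σ k) := by
  have hQ' : Qᴴ * Q = 1 := Matrix.mem_unitaryGroup_iff'.1 hQ
  have h1 : Φᴴ * Φ = (Q * Φ)ᴴ * (Q * Φ) := by
    rw [Matrix.conjTranspose_mul, Matrix.mul_assoc, ← Matrix.mul_assoc Qᴴ, hQ', Matrix.one_mul]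
  rw [h1]
  rw [Matrix.mul_apply, Matrix.mul_apply, Finset.mul_sum]
  refine Finset.sum_congr rfl fun i _ => ?_
  rw [Matrix.conjTranspose_apply, Matrix.conjTranspose_apply, h, h, star_mul]; ring

theorem gram_apply_self_of_switching {Φ : Matrix m ι ℂ} {Ψ : Matrix m κ ℂ} {Q : Matrix m m ℂ}
    {σ : κ → ι} {d : κ → ℂ} (hQ : Q ∈ Matrix.unitaryGroup m ℂ) (hd : ∀ j, ‖d j‖ = 1)
    (h : ∀ i j, Ψ i j = d j * (Q * Φ) i (σ j)) (hΦ : ∀ j, (Φᴴ * Φ) j j = 1) (j : κ) :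
    (Ψᴴ * Ψ) j j = 1 := by
  rw [gram_apply_of_switching hQ h, hΦ, mul_one, Complex.star_def, Complex.conj_mul', hd]
  simp

theorem norm_gram_apply_of_switching {Φ : Matrix m ι ℂ} {Ψ : Matrix m κ ℂ} {Q : Matrix m m ℂ}
    {σ : κ → ι} {d : κ → ℂ} (hQ : Q ∈ Matrix.unitaryGroup m ℂ) (hd : ∀ j, ‖d j‖ = 1)
    (h : ∀ i j, Ψ i j = d j * (Q * Φ) i (σ j)) (j k : κ) :
    ‖(Ψᴴ * Ψ) j k‖ = ‖(Φᴴ * Φ) (σ j) (σ k)‖ := by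
  rw [gram_apply_of_switching hQ h, norm_mul, norm_mul, norm_star, hd, hd, one_mul, one_mul]

theorem SwitchingEquiv.symm {Φ : Matrix m ι ℂ} {Ψ : Matrix m κ ℂ} (h : SwitchingEquiv Φ Ψ) :
    SwitchingEquiv Ψ Φ := by
  obtain ⟨Q, σ, d, hQ, hd, hΨ⟩ := h
  refine ⟨Qᴴ, σ.symm, fun j => star (d (σ.symm j)), Unitary.star_mem hQ, fun j => ?_, fun i j => ?_⟩
  · rw [norm_star, hd]
  · have h1 : (Qᴴ * Ψ) i (σ.symm j) = d (σ.symm j) * (Qᴴ * (Q * Φ)) i j := by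
      rw [Matrix.mul_apply, Matrix.mul_apply, Finset.mul_sum]
      refine Finset.sum_congr rfl fun k _ => ?_
      rw [hΨ, Equiv.apply_symm_apply]; ring
    have hQ' : Qᴴ * Q = 1 := Matrix.mem_unitaryGroup_iff'.1 hQ
    rw [h1, ← Matrix.mul_assoc, hQ', Matrix.one_mul, ← mul_assoc, Complex.star_def,
      Complex.conj_mul', hd]
    simp

/-- Reordering and rephasing the vectors preserves the switching class. -/
theorem SwitchingEquiv.trans_monomial {κ' : Type*} {Φ : Matrix m ι ℂ} {Ψ : Matrix m κ ℂ}
    {Ψ' : Matrix m κ' ℂ} (h : SwitchingEquiv Φ Ψ) (τ : κ' ≃ κ) (e : κ' → ℂ) (he : ∀ j, ‖e j‖ = 1)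
    (h' : ∀ i j, Ψ' i j = e j * Ψ i (τ j)) : SwitchingEquiv Φ Ψ' := by
  obtain ⟨Q, σ, d, hQ, hd, hΨ⟩ := h
  refine ⟨Q, τ.trans σ, fun j => e j * d (τ j), hQ, fun j => ?_, fun i j => ?_⟩
  · rw [norm_mul, he, hd, one_mul]
  · rw [h', hΨ, mul_assoc]; rfl

variable [Fintype ι]

open scoped ComplexOrder in
/-- A frame of `2n` vectors in dimension `n` whose Gram matrix is twice a projection of rank `n`
has frame operator `2`: the difference `ΦΦᴴ - 2` has zero Frobenius norm. -/
theorem mul_conjTranspose_eq_two {Φ : Matrix m ι ℂ} {G : Matrix ι ι ℂ} (hG : Φᴴ * Φ = G)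
    (hG2 : G * G = (2 : ℂ) • G) (htr : G.trace = 2 * Fintype.card m) :
    Φ * Φᴴ = (2 : ℂ) • 1 := by
  have hE : (Φ * Φᴴ - (2 : ℂ) • (1 : Matrix m m ℂ))ᴴ = Φ * Φᴴ - (2 : ℂ) • 1 := by
    simp [Matrix.conjTranspose_sub]
  rw [← sub_eq_zero, ← Matrix.trace_conjTranspose_mul_self_eq_zero_iff, hE]
  have h1 : (Φ * Φᴴ).trace = G.trace := by rw [Matrix.trace_mul_comm, hG]
  have h2 : (Φ * Φᴴ * (Φ * Φᴴ)).trace = (G * G).trace := by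
    rw [Matrix.mul_assoc, Matrix.trace_mul_comm, ← Matrix.mul_assoc, hG, Matrix.mul_assoc, hG]
  have h3 : (Φ * Φᴴ - (2 : ℂ) • (1 : Matrix m m ℂ)) * (Φ * Φᴴ - (2 : ℂ) • 1)
      = Φ * Φᴴ * (Φ * Φᴴ) - (4 : ℂ) • (Φ * Φᴴ) + (4 : ℂ) • 1 := by
    simp only [Matrix.mul_sub, Matrix.sub_mul, Matrix.smul_mul, Matrix.mul_smul, Matrix.mul_one,
      Matrix.one_mul]
    module
  rw [h3, Matrix.trace_add, Matrix.trace_sub, Matrix.trace_smul, Matrix.trace_smul, h1, h2, hG2,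
    Matrix.trace_smul, htr, Matrix.trace_one]
  simp only [smul_eq_mul]; ring

theorem isTightFrame_of_mul_conjTranspose {Φ : Matrix m ι ℂ} (h : Φ * Φᴴ = (2 : ℂ) • 1) :
    IsTightFrame Φ := by
  refine ⟨2, two_pos, fun x => ?_⟩
  have hn : ((∑ i, ‖x i‖ ^ 2 : ℝ) : ℂ) = star x ⬝ᵥ x := by
    simp [dotProduct, Complex.conj_mul']
  have hn' (y : ι → ℂ) : ((∑ i, ‖y i‖ ^ 2 : ℝ) : ℂ) = star y ⬝ᵥ y := by
    simp [dotProduct, Complex.conj_mul']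
  have hy : (fun j => ∑ i, star (Φ i j) * x i) = Φᴴ *ᵥ x := by
    ext j; simp [Matrix.mulVec, dotProduct]
  apply Complex.ofReal_injective
  rw [hn' (fun j => ∑ i, star (Φ i j) * x i), hy, Complex.ofReal_mul, hn, Matrix.star_mulVec,
    Matrix.conjTranspose_conjTranspose, ← Matrix.dotProduct_mulVec, Matrix.mulVec_mulVec, h]
  simp [Matrix.smul_mulVec]

theorem SwitchingEquiv.mul_conjTranspose_eq_two [Fintype κ] {Φ : Matrix m ι ℂ} {Ψ : Matrix m κ ℂ}
    (h : SwitchingEquiv Φ Ψ) (hΦ : Φ * Φᴴ = (2 : ℂ) • 1) : Ψ * Ψᴴ = (2 : ℂ) • 1 := by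
  obtain ⟨Q, σ, d, hQ, hd, hΨ⟩ := h
  have hQ' : Q * Qᴴ = 1 := Matrix.mem_unitaryGroup_iff.1 hQ
  have h1 : Ψ * Ψᴴ = (Q * Φ) * (Q * Φ)ᴴ := by
    ext i k
    rw [Matrix.mul_apply, Matrix.mul_apply, ← Equiv.sum_comp σ]
    refine Finset.sum_congr rfl fun j _ => ?_
    have hdj : d j * star (d j) = 1 := by
      rw [Complex.star_def, Complex.mul_conj', hd]; simp
    rw [Matrix.conjTranspose_apply, Matrix.conjTranspose_apply, hΨ, hΨ, star_mul]
    linear_combination ((Q * Φ) i (σ j) * star ((Q * Φ) k (σ j))) * hdj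
  rw [h1, Matrix.conjTranspose_mul, Matrix.mul_assoc, ← Matrix.mul_assoc Φ, hΦ, Matrix.smul_mul,
    Matrix.one_mul, Matrix.mul_smul, hQ']

/-- A configuration switching equivalent to equiangular unit vectors with frame operator `2` is an
equiangular tight frame. -/
theorem SwitchingEquiv.isETF [Fintype κ] {Φ : Matrix m ι ℂ} {Ψ : Matrix m κ ℂ}
    (h : SwitchingEquiv Φ Ψ) (hΦ : Φ * Φᴴ = (2 : ℂ) • 1) (h1 : ∀ j, (Φᴴ * Φ) j j = 1) {c : ℝ}
    (hc : ∀ j k, j ≠ k → ‖(Φᴴ * Φ) j k‖ = c) : IsETF Ψ := by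
  have htight := isTightFrame_of_mul_conjTranspose (h.mul_conjTranspose_eq_two hΦ)
  obtain ⟨Q, σ, d, hQ, hd, hΨ⟩ := h
  refine ⟨hasUnitColumns_iff.2 (gram_apply_self_of_switching hQ hd hΨ h1), htight, c,
    fun j k hjk => ?_⟩
  change ‖(Ψᴴ * Ψ) j k‖ = c
  rw [norm_gram_apply_of_switching hQ hd hΨ, hc _ _ (σ.injective.ne hjk)]

end GramMatrices

/-! ### The Gram matrix of a skew Hadamard matrix -/

section SkewGram
variable {ι : Type*} [Fintype ι] [DecidableEq ι] {H : Matrix ι ι ℂ}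

theorem IsSkewHadamard.apply_self (hH : IsSkewHadamard H) (i : ι) : H i i = 1 := by
  have h := congrFun (congrFun hH.2.2 i) i
  simp only [Matrix.add_apply, Matrix.transpose_apply, Matrix.smul_apply, Matrix.one_apply_eq,
    smul_eq_mul] at h
  linear_combination h / 2

theorem IsSkewHadamard.skewGram_apply_self (hH : IsSkewHadamard H) (i : ι) :
    skewGram H i i = 1 := by
  simp [skewGram, hH.apply_self]

theorem IsSkewHadamard.norm_skewGram_apply (hH : IsSkewHadamard H) {i j : ι} (hij : i ≠ j) :
    ‖skewGram H i j‖ = 1 / √((Fintype.card ι : ℝ) - 1) := by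
  have h : ‖H i j‖ = 1 := by rcases hH.1 i j with h | h <;> simp [h]
  simp [skewGram, hij, h, abs_of_nonneg (Real.sqrt_nonneg _)]

theorem IsSkewHadamard.trace_skewGram (hH : IsSkewHadamard H) :
    (skewGram H).trace = Fintype.card ι := by
  simp [Matrix.trace, hH.skewGram_apply_self]

theorem IsSkewHadamard.skewGram_mul_self (hH : IsSkewHadamard H) (hι : 1 < Fintype.card ι) :
    skewGram H * skewGram H = (2 : ℂ) • skewGram H := by
  have hpos : (0 : ℝ) < (Fintype.card ι : ℝ) - 1 := by
    have : (1 : ℝ) < Fintype.card ι := by exact_mod_cast hι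
    linarith
  have hK : (H - 1) * (H - 1) = (1 - (Fintype.card ι : ℂ)) • (1 : Matrix ι ι ℂ) := by
    have h1 := hH.2.1
    rw [eq_sub_of_add_eq' hH.2.2] at h1
    simp only [Matrix.mul_sub, Matrix.mul_smul, Matrix.mul_one] at h1
    simp only [Matrix.mul_sub, Matrix.sub_mul, Matrix.mul_one, Matrix.one_mul]
    rw [sub_smul, ← h1]
    module
  have hz : (Complex.I / (√((Fintype.card ι : ℝ) - 1) : ℂ)) ^ 2 * (1 - (Fintype.card ι : ℂ))
      = 1 := by
    have hs : ((√((Fintype.card ι : ℝ) - 1) : ℝ) : ℂ) ^ 2 = (Fintype.card ι : ℂ) - 1 := by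
      rw [← Complex.ofReal_pow, Real.sq_sqrt hpos.le]; push_cast; rfl
    have hne : (Fintype.card ι : ℂ) - 1 ≠ 0 := by
      rw [← hs, ← Complex.ofReal_pow, Real.sq_sqrt hpos.le]; exact_mod_cast hpos.ne'
    rw [div_pow, hs, Complex.I_sq]; field_simp; ring
  unfold skewGram
  generalize Complex.I / (√((Fintype.card ι : ℝ) - 1) : ℂ) = z at hz
  have hK' : (z • (H - 1)) * (z • (H - 1)) = 1 := by
    rw [Matrix.smul_mul, Matrix.mul_smul, hK, smul_smul, smul_smul, ← sq, hz, one_smul]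
  rw [Matrix.mul_add, Matrix.add_mul, Matrix.add_mul, hK', Matrix.mul_one, Matrix.mul_one,
    Matrix.one_mul]
  module

theorem skewGram_commute {D : Matrix ι ι ℂ} (h : D * H = H * D) :
    D * skewGram H = skewGram H * D := by
  simp [skewGram, Matrix.mul_add, Matrix.add_mul, Matrix.mul_sub, Matrix.sub_mul, h]

end SkewGram

/-! ### Genuinely projective representations -/

section Genuineness
variable {G m : Type*} [Group G] [Fintype m] [DecidableEq m] [Nonempty m]

/-- A projective representation under which two commuting elements anticommute is genuine:
the commutator of the images of two commuting elements does not change under projective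
equivalence, and is trivial for a strict representation. -/
theorem isGenuineProjRep_of_anticommute {π : G → Matrix m m ℂ} (hπ : IsProjUnitaryRep π) {g h : G}
    (hgh : g * h = h * g) (ha : π g * π h = -(π h * π g)) : IsGenuineProjRep π := by
  refine ⟨hπ, ?_⟩
  rintro ⟨ρ, Q, hQ, hρ⟩
  have hQ1 : Qᴴ * Q = 1 := Matrix.mem_unitaryGroup_iff'.1 hQ
  have hconj (X Y : Matrix m m ℂ) : Q * X * Qᴴ * (Q * Y * Qᴴ) = Q * (X * Y) * Qᴴ := by
    calc Q * X * Qᴴ * (Q * Y * Qᴴ) = Q * X * (Qᴴ * Q) * Y * Qᴴ := by noncomm_ring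
      _ = _ := by rw [hQ1]; noncomm_ring
  obtain ⟨a, ha1, hag⟩ := hρ g
  obtain ⟨b, hb1, hbh⟩ := hρ h
  have h1 := hconj (π g) (π h)
  have h2 := hconj (π h) (π g)
  have hc : (ρ g : Matrix m m ℂ) * ρ h = ρ h * ρ g := by
    have := congrArg (Subtype.val) ((map_mul ρ g h).symm.trans ((congrArg ρ hgh).trans
      (map_mul ρ h g)))
    exact this
  rw [ha, hag, hbh] at h1
  rw [hag, hbh] at h2
  simp only [Matrix.smul_mul, Matrix.mul_smul, smul_smul, mul_comm b a] at h1 h2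
  rw [hc, h2, Matrix.mul_neg, Matrix.neg_mul] at h1
  have h0 : Q * (π h * π g) * Qᴴ = 0 := by
    ext i j
    exact self_eq_neg.1 (congrFun (congrFun h1 i) j)
  have hU : Q * (π h * π g) * Qᴴ ∈ Matrix.unitaryGroup m ℂ :=
    mul_mem (mul_mem hQ (mul_mem (hπ.1 h) (hπ.1 g))) (Unitary.star_mem hQ)
  rw [h0, Matrix.mem_unitaryGroup_iff'] at hU
  simp at hU

end Genuineness

/-! ### Compression of operators to the span of a frame -/

section Compression
variable {m ι : Type*} [Fintype m] [DecidableEq m] [Fintype ι]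

/-- The operator on the span of the frame `Φ` (with frame operator `2`) that is induced by an
operator `D` on the coefficients. -/
noncomputable def compression (Φ : Matrix m ι ℂ) (D : Matrix ι ι ℂ) : Matrix m m ℂ :=
  (1 / 2 : ℂ) • (Φ * D * Φᴴ)

variable {Φ : Matrix m ι ℂ} (hΦ : Φ * Φᴴ = (2 : ℂ) • 1) {D E : Matrix ι ι ℂ}
include hΦ

theorem compression_mul_frame (hD : D * (Φᴴ * Φ) = Φᴴ * Φ * D) : compression Φ D * Φ = Φ * D := by
  have h : Φ * D * Φᴴ * Φ = (2 : ℂ) • (Φ * D) := by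
    calc Φ * D * Φᴴ * Φ = Φ * (D * (Φᴴ * Φ)) := by simp only [Matrix.mul_assoc]
      _ = Φ * Φᴴ * (Φ * D) := by rw [hD]; simp only [Matrix.mul_assoc]
      _ = _ := by rw [hΦ, Matrix.smul_mul, Matrix.one_mul]
  rw [compression, Matrix.smul_mul, h, smul_smul]; norm_num

theorem compression_mul (hD : D * (Φᴴ * Φ) = Φᴴ * Φ * D) :
    compression Φ D * compression Φ E = compression Φ (D * E) := by
  conv_lhs => rw [compression.eq_1 Φ E]
  rw [Matrix.mul_smul, Matrix.mul_assoc Φ, ← Matrix.mul_assoc (compression Φ D),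
    compression_mul_frame hΦ hD, compression]
  simp only [Matrix.mul_assoc]

theorem compression_mem_unitaryGroup [DecidableEq ι] (hD : D * (Φᴴ * Φ) = Φᴴ * Φ * D)
    (hU : D ∈ Matrix.unitaryGroup ι ℂ) : compression Φ D ∈ Matrix.unitaryGroup m ℂ := by
  have hU' : D * Dᴴ = 1 := Matrix.mem_unitaryGroup_iff.1 hU
  have hs : (compression Φ D)ᴴ = compression Φ Dᴴ := by
    simp [compression, Matrix.conjTranspose_mul, Matrix.mul_assoc]
  rw [Matrix.mem_unitaryGroup_iff, Matrix.star_eq_conjTranspose, hs, compression_mul hΦ hD, hU',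
    compression, Matrix.mul_one, hΦ, smul_smul]
  norm_num

theorem isProjUnitaryRep_compression [DecidableEq ι] {G : Type*} [Group G] {R : G → Matrix ι ι ℂ}
    (hR : IsProjUnitaryRep R) (hc : ∀ g, R g * (Φᴴ * Φ) = Φᴴ * Φ * R g) :
    IsProjUnitaryRep fun g => compression Φ (R g) := by
  refine ⟨fun g => compression_mem_unitaryGroup hΦ (hc g) (hR.1 g), fun g h => ?_⟩
  obtain ⟨c, hc1, hc2⟩ := hR.2 g h
  refine ⟨c, hc1, ?_⟩
  change compression Φ (R (g * h)) = c • (compression Φ (R g) * compression Φ (R h))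
  rw [compression_mul hΦ (hc g), hc2, compression, compression, Matrix.mul_smul, Matrix.smul_mul,
    smul_comm]

end Compression

/-! ### Existence of double Paley frames -/

section Existence

/-- Real coefficients for the square root `a + b X` of `1 + X / t`, where `X ^ 2 = q`, together with
`δ = (a + b X) (a - b X)`. -/
theorem exists_sqrt_coefficients {q t : ℝ} (hq : 0 < q) (ht : 0 < t) (hqt : t ^ 2 = 2 * q + 1) :
    ∃ a b δ : ℝ, a ^ 2 + b ^ 2 * q = 1 ∧ 2 * a * b = 1 / t ∧ a ^ 2 - b ^ 2 * q = δ ∧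
      t ^ 2 * δ ^ 2 = q + 1 := by
  -- `a ± b √q` are the square roots of the two eigenvalues `1 ± √q / t`
  have hr : 0 < √q := Real.sqrt_pos.2 hq
  have hr2 : √q ^ 2 = q := Real.sq_sqrt hq.le
  have hle : √q / t ≤ 1 := by
    rw [div_le_one ht]; nlinarith
  have hnn : 0 ≤ √q / t := by positivity
  have hx2 : √(1 + √q / t) ^ 2 = 1 + √q / t := Real.sq_sqrt (by linarith)
  have hy2 : √(1 - √q / t) ^ 2 = 1 - √q / t := Real.sq_sqrt (by linarith)
  generalize √(1 + √q / t) = x at hx2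
  generalize √(1 - √q / t) = y at hy2
  generalize √q = r at *
  subst hr2
  refine ⟨(x + y) / 2, (x - y) / (2 * r), x * y, ?_, ?_, ?_, ?_⟩
  · field_simp; linear_combination 2 * hx2 + 2 * hy2
  · have : 2 * ((x + y) / 2) * ((x - y) / (2 * r)) = (x ^ 2 - y ^ 2) / (2 * r) := by
      field_simp; ring
    rw [this, hx2, hy2]; field_simp; ring
  · field_simp; ring
  · rw [mul_pow, hx2, hy2]; field_simp; linear_combination hqt

/-- The frame is `[A, A⁻¹ H / √(2n - 1)]`, where `A` is the positive square root of the upper left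
block of the Gram matrix; since the conference matrix squares to a scalar, `A` is a linear
polynomial in it. -/
theorem exists_frame_blockGram {F : Type*} [Field F] [Fintype F] (s : PointLift F)
    (h4 : Fintype.card F % 4 = 3) :
    ∃ Ψ : Matrix (ProjLine F) (ProjLine F ⊕ ProjLine F) ℂ,
      Ψᴴ * Ψ = blockGram (doublePaley s) := by
  set q : ℝ := (Fintype.card F : ℝ) with hq
  have hq0 : 0 < q := by rw [hq]; exact_mod_cast Fintype.card_pos
  set t : ℝ := √(2 * (Fintype.card (ProjLine F) : ℝ) - 1) with ht
  have hqt' : 2 * (Fintype.card (ProjLine F) : ℝ) - 1 = 2 * q + 1 := by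
    rw [card_projLine]; push_cast; ring
  have ht0 : 0 < t := by rw [ht, hqt']; positivity
  have hqt : t ^ 2 = 2 * q + 1 := by rw [ht, hqt', Real.sq_sqrt (by positivity)]
  obtain ⟨a, b, δ, h1, h2, h3, h5⟩ := exists_sqrt_coefficients hq0 ht0 hqt
  have hδ : δ ≠ 0 := by rintro rfl; nlinarith
  have h1' : (a : ℂ) ^ 2 + (b : ℂ) ^ 2 * q = 1 := by exact_mod_cast h1
  have h2' : 2 * (a : ℂ) * b = 1 / t := by exact_mod_cast h2
  have h3' : (a : ℂ) ^ 2 - (b : ℂ) ^ 2 * q = δ := by exact_mod_cast h3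
  have h5' : (t : ℂ) ^ 2 * (δ : ℂ) ^ 2 = q + 1 := by exact_mod_cast h5
  have ht0' : (t : ℂ) ≠ 0 := by exact_mod_cast ht0.ne'
  have hδ' : (δ : ℂ) ≠ 0 := by exact_mod_cast hδ
  set C := paleyConf s with hC
  have hC1 : Cᴴ = -C := paleyConf_conjTranspose s h4
  have hC2 : C * C = -((q : ℂ) • 1) := by
    rw [hC, paleyConf_mul_self s h4, hq]; push_cast; rfl
  set X := Complex.I • C with hX
  have hX1 : Xᴴ = X := by simp [hX, hC1]
  have hX2 : X * X = (q : ℂ) • 1 := by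
    rw [hX, Matrix.smul_mul, Matrix.mul_smul, smul_smul, Complex.I_mul_I, hC2]; simp
  have hCX : C = -(Complex.I • X) := by
    rw [hX, smul_smul, Complex.I_mul_I, neg_one_smul, neg_neg]
  have hlin (x y z w : ℂ) : (x • (1 : Matrix (ProjLine F) (ProjLine F) ℂ) + y • X) * (z • 1 + w • X)
      = (x * z + y * w * q) • 1 + (x * w + y * z) • X := by
    simp only [Matrix.mul_add, Matrix.add_mul, Matrix.smul_mul, Matrix.mul_smul, Matrix.mul_one,
      Matrix.one_mul, hX2, smul_smul]
    module
  set A : Matrix (ProjLine F) (ProjLine F) ℂ := (a : ℂ) • 1 + (b : ℂ) • X with hA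
  have hAH : Aᴴ = A := by
    simp [hA, Matrix.conjTranspose_add, Matrix.conjTranspose_smul, hX1]
  have hAA : A * A = 1 + (1 / (t : ℂ)) • X := by
    rw [hA, hlin]
    rw [show (a : ℂ) * a + b * b * q = 1 by linear_combination h1',
      show (a : ℂ) * b + b * a = 1 / t by linear_combination h2', one_smul]
  set B : Matrix (ProjLine F) (ProjLine F) ℂ := (1 / (t * δ) : ℂ) •
    (((a : ℂ) • 1 + (-b : ℂ) • X) * ((1 : ℂ) • 1 + (-Complex.I) • X)) with hB
  have hBH : Bᴴ = (1 / (t * δ) : ℂ) •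
      (((1 : ℂ) • 1 + Complex.I • X) * ((a : ℂ) • 1 + (-b : ℂ) • X)) := by
    simp [hB, Matrix.conjTranspose_add, Matrix.conjTranspose_smul, Matrix.conjTranspose_mul, hX1]
  have hAB : A * B = (1 / (t : ℂ)) • (1 + C) := by
    rw [hB, hA, Matrix.mul_smul, ← Matrix.mul_assoc, hlin,
      show (a : ℂ) * a + b * -b * q = δ by linear_combination h3',
      show (a : ℂ) * -b + b * a = 0 by ring, zero_smul, add_zero, Matrix.smul_mul, Matrix.one_mul,
      smul_smul, hCX, one_smul, neg_smul]
    congr 1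
    field_simp
  have hBB : Bᴴ * B = 1 - (1 / (t : ℂ)) • X := by
    rw [hBH, hB, Matrix.smul_mul, Matrix.mul_smul, smul_smul]
    have hI := Complex.I_sq
    have e1 : (1 / (t * δ) : ℂ) * (1 / (t * δ)) * (q + 1) = 1 := by
      rw [← h5']; field_simp
    rw [hlin, hlin, hlin, smul_add, smul_smul, smul_smul, sub_eq_add_neg, ← neg_smul]
    congr 1
    · rw [← one_smul ℂ (1 : Matrix (ProjLine F) (ProjLine F) ℂ), smul_smul, mul_one]
      congr 1
      linear_combination e1 + (1 / (t * δ) : ℂ) * (1 / (t * δ)) * ((q + 1) * h1'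
        - (a ^ 2 * q + b ^ 2 * q ^ 2) * (hI))
    · congr 1
      linear_combination (-1 / t : ℂ) * e1 - (1 / (t * δ) : ℂ) * (1 / (t * δ)) * ((q + 1) * h2'
        - (2 * a * b * q) * (hI))
  refine ⟨Matrix.fromCols A B, ?_⟩
  rw [Matrix.conjTranspose_fromCols_eq_fromRows_conjTranspose, Matrix.fromRows_mul_fromCols,
    hAH, hAA, hAB, hBB]
  have hBA : Bᴴ * A = (1 / (t : ℂ)) • (1 - C) := by
    have := congrArg Matrix.conjTranspose hAB
    rw [Matrix.conjTranspose_mul, hAH] at this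
    rw [this]
    simp [hC1, sub_eq_add_neg]
  rw [hBA, blockGram, ← ht, doublePaley, doubling, paley_transpose s h4, paley_eq, ← hC]
  simp only [Matrix.toBlocks_fromBlocks₁₁, Matrix.toBlocks_fromBlocks₁₂,
    Matrix.toBlocks_fromBlocks₂₂, Matrix.fromBlocks_smul, ← Matrix.fromBlocks_one,
    Matrix.fromBlocks_add]
  congr 1
  · rw [hX]; simp
  · simp
  · have hCT : Cᵀ = -C := paleyConf_transpose s h4
    simp [hCT, sub_eq_add_neg]
  · rw [hX]; simp [sub_eq_add_neg]

end Existence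

/-! ### Recognizing dihedral groups -/

section Dihedral
variable {G : Type*} [Group G]

/-- The homomorphism from a dihedral group determined by a rotation `m` with `m ^ n = 1` and an
involution `t` inverting `m`. -/
noncomputable def dihedralHom {n : ℕ} {m t : G} (hm : m ^ n = 1) (ht : t * t = 1)
    (htm : t * m * t = m⁻¹) : DihedralGroup n →* G :=
  let f : Multiplicative (ZMod n) →* G := AddMonoidHom.toMultiplicativeLeft
    (ZMod.lift n ⟨(zmultiplesHom (Additive G)) (Additive.ofMul m), by
      rw [zmultiplesHom_apply, ← ofMul_zpow, zpow_natCast, hm, ofMul_one]⟩)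
  have hf (i : ZMod n) : f (Multiplicative.ofAdd i) * t = t * (f (Multiplicative.ofAdd i))⁻¹ := by
    obtain ⟨k, rfl⟩ := ZMod.intCast_surjective i
    have h1 : f (Multiplicative.ofAdd (k : ZMod n)) = m ^ k := by
      simp [f]
    have h2 : t⁻¹ = t := inv_eq_of_mul_eq_one_left ht
    have h3 := conj_zpow (i := k) (a := t) (b := m)
    rw [h2, htm] at h3
    rw [h1, ← inv_zpow, h3, ← mul_assoc, ← mul_assoc, ht, one_mul]
  have hcomm (i j : ZMod n) : (f (Multiplicative.ofAdd i))⁻¹ * f (Multiplicative.ofAdd j)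
      = f (Multiplicative.ofAdd j) / f (Multiplicative.ofAdd i) := by
    rw [← map_inv, ← map_mul, mul_comm, map_mul, map_inv, div_eq_mul_inv]
  { toFun := fun x => match x with
      | DihedralGroup.r i => f (Multiplicative.ofAdd i)
      | DihedralGroup.sr i => t * f (Multiplicative.ofAdd i)
    map_one' := by
      change f 1 = 1
      exact map_one f
    map_mul' := by
      rintro (i | i) (j | j)
      · simp [DihedralGroup.r_mul_r, ofAdd_add]
      · simp only [DihedralGroup.r_mul_sr, ofAdd_sub, map_div]
        rw [← mul_assoc, hf, mul_assoc, hcomm]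
      · simp [DihedralGroup.sr_mul_r, ofAdd_add, mul_assoc]
      · simp only [DihedralGroup.sr_mul_sr, ofAdd_sub, map_div]
        rw [mul_assoc, ← mul_assoc _ t, hf, mul_assoc, hcomm, ← mul_assoc, ht, one_mul] }

section
variable {n : ℕ} {m t : G} (hm : m ^ n = 1) (ht : t * t = 1) (htm : t * m * t = m⁻¹)

theorem dihedralHom_r (k : ℤ) : dihedralHom hm ht htm (DihedralGroup.r (k : ZMod n)) = m ^ k := by
  simp [dihedralHom]

theorem dihedralHom_sr (k : ℤ) :
    dihedralHom hm ht htm (DihedralGroup.sr (k : ZMod n)) = t * m ^ k := by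
  simp [dihedralHom]

theorem range_dihedralHom : (dihedralHom hm ht htm).range = Subgroup.closure {m, t} := by
  apply le_antisymm
  · have h1 : m ∈ Subgroup.closure {m, t} := Subgroup.subset_closure (by simp)
    have h2 : t ∈ Subgroup.closure {m, t} := Subgroup.subset_closure (by simp)
    rintro _ ⟨i | i, rfl⟩ <;> obtain ⟨k, rfl⟩ := ZMod.intCast_surjective i
    · rw [dihedralHom_r]; exact zpow_mem h1 k
    · rw [dihedralHom_sr]; exact mul_mem h2 (zpow_mem h1 k)
  · rw [Subgroup.closure_le]
    rintro x (rfl | rfl)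
    · exact ⟨DihedralGroup.r ((1 : ℤ) : ZMod n), by rw [dihedralHom_r, zpow_one]⟩
    · exact ⟨DihedralGroup.sr ((0 : ℤ) : ZMod n), by rw [dihedralHom_sr, zpow_zero, mul_one]⟩

include hm ht htm in
theorem exists_zpow_of_mem_closure_pair {x : G} (hx : x ∈ Subgroup.closure {m, t}) :
    ∃ k : ℤ, x = m ^ k ∨ x = t * m ^ k := by
  rw [← range_dihedralHom hm ht htm] at hx
  obtain ⟨i | i, rfl⟩ := hx <;> obtain ⟨k, rfl⟩ := ZMod.intCast_surjective i
  · exact ⟨k, Or.inl (dihedralHom_r hm ht htm k)⟩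
  · exact ⟨k, Or.inr (dihedralHom_sr hm ht htm k)⟩

end

theorem exists_mulEquiv_dihedralGroup {n : ℕ} {m t : G} (hm : orderOf m = n) (ht : t * t = 1)
    (htm : t * m * t = m⁻¹) (htn : t ∉ Subgroup.zpowers m) :
    ∃ e : Subgroup.closure {m, t} ≃* DihedralGroup n,
      (e.symm (DihedralGroup.r 1) : G) = m ∧ (e.symm (DihedralGroup.sr 0) : G) = t := by
  have hm' : m ^ n = 1 := by rw [← hm, pow_orderOf_eq_one]
  have hinj : Function.Injective (dihedralHom hm' ht htm) := by
    rw [injective_iff_map_eq_one]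
    rintro (i | i) hi <;> obtain ⟨k, rfl⟩ := ZMod.intCast_surjective i
    · rw [dihedralHom_r, ← orderOf_dvd_iff_zpow_eq_one, hm,
        ← CharP.intCast_eq_zero_iff (ZMod n) n] at hi
      rw [hi]; rfl
    · rw [dihedralHom_sr, mul_eq_one_iff_eq_inv, ← zpow_neg] at hi
      exact absurd ⟨-k, hi.symm⟩ htn
  let e := (MonoidHom.ofInjective hinj).trans
    (MulEquiv.subgroupCongr (range_dihedralHom hm' ht htm))
  have he (x : DihedralGroup n) : (e.symm.symm x : G) = dihedralHom hm' ht htm x := rfl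
  refine ⟨e.symm, ?_, ?_⟩
  · rw [he]
    simpa using dihedralHom_r hm' ht htm 1
  · rw [he]
    simpa using dihedralHom_sr hm' ht htm 0

end Dihedral

/-! ### Rotations of the projective line -/

section Rotations
variable {F : Type*} [Field F]

theorem mk_eq_one_of_eq_smul_one {A : GL (Fin 2) F} (c : F)
    (h : (A : Matrix (Fin 2) (Fin 2) F) = c • 1) : (Matrix.ProjGenLinGroup.mk A : PGL2 F) = 1 := by
  have hc : c ≠ 0 := by
    rintro rfl
    have := A.isUnit
    rw [h, zero_smul] at this
    exact not_isUnit_zero this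
  rw [show A = Matrix.GeneralLinearGroup.scalar (Fin 2) (Units.mk0 c hc) from Units.ext (by
    rw [h]; simp [Matrix.GeneralLinearGroup.coe_scalar, Matrix.smul_one_eq_diagonal])]
  exact Matrix.ProjGenLinGroup.mk_scalar _

theorem sq_add_sq_ne_zero (z : (QuadraticAlgebra F (-1) 0)ˣ) : z.1.re ^ 2 + z.1.im ^ 2 ≠ 0 := by
  have h := QuadraticAlgebra.isUnit_iff_norm_isUnit.1 z.isUnit
  rw [isUnit_iff_ne_zero, QuadraticAlgebra.norm_def] at h
  intro h0
  apply h
  linear_combination h0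

theorem rotElt_zpow (u : (QuadraticAlgebra F (-1) 0)ˣ) (k : ℤ) : rotElt u ^ k = rotElt (u ^ k) :=
  (map_zpow ((Matrix.ProjGenLinGroup.mk : GL (Fin 2) F →* PGL2 F).comp
    (Units.map (mulMatrix F))) u k).symm

variable [Fintype F]

theorem eq_zero_of_sq_add_sq (h4 : Fintype.card F % 4 = 3) {x y : F} (h : x ^ 2 + y ^ 2 = 0) :
    x = 0 ∧ y = 0 := by
  have hy : y = 0 := by
    by_contra hy
    refine not_isSquare_neg_one h4 ⟨x / y, ?_⟩
    field_simp
    linear_combination -h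
  subst hy
  exact ⟨by simpa using h, rfl⟩

theorem two_ne_zero_of_card (h4 : Fintype.card F % 4 = 3) : (2 : F) ≠ 0 := fun h2 =>
  not_isSquare_neg_one h4 ⟨1, by linear_combination -h2⟩

theorem isUnit_quadraticAlgebra (h4 : Fintype.card F % 4 = 3) {x y : F} (h : x ≠ 0 ∨ y ≠ 0) :
    IsUnit (⟨x, y⟩ : QuadraticAlgebra F (-1) 0) := by
  rw [QuadraticAlgebra.isUnit_iff_norm_isUnit, isUnit_iff_ne_zero, QuadraticAlgebra.norm_def]
  intro h0
  have := eq_zero_of_sq_add_sq h4 (x := x) (y := y) (by linear_combination h0)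
  tauto

/-- A rotation has no fixed points: the eigenvalues of `[x, y; -y, x]` with `y ≠ 0` do not lie
in the base field. -/
theorem rotElt_eq_one_of_smul_eq (h4 : Fintype.card F % 4 = 3) (s : PointLift F)
    {z : (QuadraticAlgebra F (-1) 0)ˣ} {P : ProjLine F} (h : rotElt z • P = P) : rotElt z = 1 := by
  obtain ⟨c, hc⟩ := s.exists_eigenvalue h
  have h0 := congrFun hc 0
  have h1 := congrFun hc 1
  simp only [Units.coe_map, mulMatrix, MonoidHom.coe_mk, OneHom.coe_mk,
    Matrix.mulVec, dotProduct, Fin.sum_univ_two, Matrix.of_apply, Matrix.cons_val',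
    Matrix.cons_val_zero, Matrix.cons_val_one, Matrix.cons_val_fin_one, Pi.smul_apply,
    smul_eq_mul] at h0 h1
  have hy : z.1.im = 0 := by
    have hmul : z.1.im * (s.vec P 0 ^ 2 + s.vec P 1 ^ 2) = 0 := by
      linear_combination s.vec P 1 * h0 - s.vec P 0 * h1
    refine (mul_eq_zero.1 hmul).resolve_right fun hv => s.vec_ne_zero P ?_
    obtain ⟨ha, hb⟩ := eq_zero_of_sq_add_sq h4 hv
    ext i; fin_cases i <;> assumption
  refine mk_eq_one_of_eq_smul_one z.1.re ?_
  ext i j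
  fin_cases i <;> fin_cases j <;> simp [mulMatrix, hy]

theorem exists_rotElt_smul (h4 : Fintype.card F % 4 = 3) (s : PointLift F) :
    ∃ P₀ : ProjLine F, ∀ P, ∃ z : (QuadraticAlgebra F (-1) 0)ˣ, rotElt z • P₀ = P := by
  have h10 : (![1, 0] : Fin 2 → F) ≠ 0 := fun h => one_ne_zero (congrFun h 0)
  refine ⟨Projectivization.mk F ![1, 0] h10, fun P => ?_⟩
  have hP : s.vec P 0 ≠ 0 ∨ -s.vec P 1 ≠ 0 := by
    by_contra! h
    exact s.vec_ne_zero P (by ext i; fin_cases i; exacts [h.1, neg_eq_zero.1 h.2])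
  obtain ⟨z, hz⟩ := isUnit_quadraticAlgebra h4 hP
  refine ⟨z, ?_⟩
  change Projectivization.mk F ((Units.map (mulMatrix F : _ →* _) z : GL (Fin 2) F) • ![1, 0])
    ((smul_ne_zero_iff_ne _).2 h10) = P
  conv_rhs => rw [← s.mk_vec P]
  rw [Projectivization.mk_eq_mk_iff']
  refine ⟨1, ?_⟩
  change (1 : F) • s.vec P = mulMatrix F z.1 *ᵥ ![1, 0]
  rw [hz]
  ext i
  fin_cases i <;> simp [mulMatrix]

/-- The rotations permute the projective line simply transitively. -/
theorem orderOf_rotElt (h4 : Fintype.card F % 4 = 3) (s : PointLift F)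
    {u : (QuadraticAlgebra F (-1) 0)ˣ} (hu : ∀ z, z ∈ Subgroup.zpowers u) :
    orderOf (rotElt u) = Fintype.card F + 1 := by
  obtain ⟨P₀, hP₀⟩ := exists_rotElt_smul h4 s
  have hbij : Function.Bijective fun g : Subgroup.zpowers (rotElt u) => (g : PGL2 F) • P₀ := by
    constructor
    · rintro ⟨_, k, rfl⟩ ⟨_, l, rfl⟩ h
      replace h : rotElt u ^ k • P₀ = rotElt u ^ l • P₀ := h
      have h1 : rotElt (u ^ (-l + k)) • P₀ = P₀ := by
        rw [← rotElt_zpow, zpow_add, mul_smul, h, ← mul_smul, ← zpow_add, neg_add_cancel, zpow_zero,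
          one_smul]
      have h2 := rotElt_eq_one_of_smul_eq h4 s h1
      rw [← rotElt_zpow, zpow_add, zpow_neg, inv_mul_eq_one] at h2
      exact Subtype.ext h2.symm
    · intro P
      obtain ⟨z, hz⟩ := hP₀ P
      obtain ⟨k, rfl⟩ := hu z
      exact ⟨⟨rotElt u ^ k, k, rfl⟩, (congrArg (· • P₀) (rotElt_zpow u k)).trans hz⟩
  rw [← Nat.card_zpowers, Nat.card_congr (Equiv.ofBijective _ hbij), Nat.card_eq_fintype_card,
    card_projLine]

end Rotations

/-! ### Reflections of the projective line -/

section Reflections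
variable {F : Type*} [Field F] {α β : F} (hαβ : α ^ 2 + β ^ 2 = -1)

/-- A product of the reflection with a rotation is represented by a traceless matrix, hence is an
involution. -/
theorem reflElt_mul_rotElt_sq (z : (QuadraticAlgebra F (-1) 0)ˣ) :
    (reflElt α β hαβ * rotElt z) * (reflElt α β hαβ * rotElt z) = 1 := by
  rw [reflElt, rotElt, ← map_mul, ← map_mul]
  refine mk_eq_one_of_eq_smul_one (-(z.1.re ^ 2 + z.1.im ^ 2)) ?_
  ext i j
  fin_cases i <;> fin_cases j <;>
    simp [mulMatrix, Matrix.mul_apply, Fin.sum_univ_two,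
      Matrix.GeneralLinearGroup.mkOfDetNeZero] <;>
    first | ring1 | linear_combination (z.1.re ^ 2 + z.1.im ^ 2) * hαβ

theorem reflElt_mul_self : reflElt α β hαβ * reflElt α β hαβ = 1 := by
  have h := reflElt_mul_rotElt_sq hαβ 1
  rwa [show rotElt (1 : (QuadraticAlgebra F (-1) 0)ˣ) = 1 by
    simp [rotElt], mul_one] at h

theorem reflElt_mul_rotElt_mul_reflElt (z : (QuadraticAlgebra F (-1) 0)ˣ) :
    reflElt α β hαβ * rotElt z * reflElt α β hαβ = (rotElt z)⁻¹ := by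
  rw [eq_inv_iff_mul_eq_one, mul_assoc, reflElt_mul_rotElt_sq]

variable [Fintype F]

theorem reflElt_ne_rotElt (h4 : Fintype.card F % 4 = 3) (z : (QuadraticAlgebra F (-1) 0)ˣ) :
    reflElt α β hαβ ≠ rotElt z := by
  intro h
  obtain ⟨c, hc⟩ := Matrix.ProjGenLinGroup.mk_eq_mk_iff.1 h
  have h2 := two_ne_zero_of_card h4
  have hent (i j : Fin 2) :=
    congrArg (fun A : GL (Fin 2) F => (A : Matrix (Fin 2) (Fin 2) F) i j) hc
  have h00 := hent 0 0
  have h01 := hent 0 1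
  have h10 := hent 1 0
  have h11 := hent 1 1
  simp [mulMatrix, Matrix.mul_apply, Fin.sum_univ_two, Matrix.GeneralLinearGroup.mkOfDetNeZero]
    at h00 h01 h10 h11
  have hα : α = 0 := by
    have : 2 * c.1 * α = 0 := by linear_combination h00 - h11
    simpa [h2] using this
  have hβ : β = 0 := by
    have : 2 * c.1 * β = 0 := by linear_combination h01 + h10
    simpa [h2] using this
  subst hα hβ
  norm_num at hαβ

theorem reflElt_mem_PSL2 : reflElt α β hαβ ∈ PSL2 F := by
  rw [reflElt, mk_mem_PSL2_iff]
  have : (!![α, β; β, -α] : Matrix (Fin 2) (Fin 2) F).det = 1 := by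
    rw [Matrix.det_fin_two_of]; linear_combination -hαβ
  simp only [Matrix.GeneralLinearGroup.mkOfDetNeZero]
  simp [this]

/-- A reflection of determinant a square has no fixed points: its eigenvalues are square roots of
the negative of its determinant. -/
theorem reflElt_mul_rotElt_smul_ne (h4 : Fintype.card F % 4 = 3) (s : PointLift F)
    {z : (QuadraticAlgebra F (-1) 0)ˣ} (hz : reflElt α β hαβ * rotElt z ∈ PSL2 F) (P : ProjLine F) :
    (reflElt α β hαβ * rotElt z) • P ≠ P := by
  intro h
  have hN : qchar (z.1.re ^ 2 + z.1.im ^ 2) = 1 := by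
    rw [reflElt, rotElt, ← map_mul, mk_mem_PSL2_iff, Units.val_mul, Matrix.det_mul] at hz
    rw [← hz]
    congr 1
    simp [mulMatrix, Matrix.det_fin_two, Matrix.GeneralLinearGroup.mkOfDetNeZero]
    linear_combination (z.1.re ^ 2 + z.1.im ^ 2) * hαβ
  obtain ⟨d, hd⟩ := (qchar_eq_one_iff (sq_add_sq_ne_zero z)).1 hN
  rw [reflElt, rotElt, ← map_mul] at h
  obtain ⟨c, hc⟩ := s.exists_eigenvalue h
  have h0 := congrFun hc 0
  have h1 := congrFun hc 1
  simp [mulMatrix, Matrix.mulVec, dotProduct, Matrix.mul_apply, Fin.sum_univ_two,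
    Matrix.GeneralLinearGroup.mkOfDetNeZero] at h0 h1
  set x := z.1.re
  set y := z.1.im
  have hc0 : (c ^ 2 + d ^ 2) * s.vec P 0 = 0 := by
    linear_combination (-(c + (α * x - β * y))) * h0 - (α * y + β * x) * h1
      + s.vec P 0 * ((x ^ 2 + y ^ 2) * hαβ - hd)
  have hc1 : (c ^ 2 + d ^ 2) * s.vec P 1 = 0 := by
    linear_combination (-(c - (α * x - β * y))) * h1 - (α * y + β * x) * h0
      + s.vec P 1 * ((x ^ 2 + y ^ 2) * hαβ - hd)
  have hcd : c ^ 2 + d ^ 2 = 0 := by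
    by_contra hne
    refine s.vec_ne_zero P ?_
    ext i; fin_cases i
    exacts [(mul_eq_zero.1 hc0).resolve_left hne, (mul_eq_zero.1 hc1).resolve_left hne]
  have := (eq_zero_of_sq_add_sq h4 hcd).2
  rw [this, mul_zero] at hd
  exact sq_add_sq_ne_zero z hd

end Reflections

/-! ### The dihedral subgroup -/

section DihedralSubgroup
variable {F : Type*} [Field F] [Fintype F] {u : (QuadraticAlgebra F (-1) 0)ˣ} {α β : F}
  (hαβ : α ^ 2 + β ^ 2 = -1)

theorem exists_dihedralSubgroup_mulEquiv (h4 : Fintype.card F % 4 = 3) (s : PointLift F)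
    (hu : ∀ z, z ∈ Subgroup.zpowers u) :
    ∃ e : dihedralSubgroup u α β hαβ ≃* DihedralGroup (Fintype.card F + 1),
      (e.symm (DihedralGroup.r 1) : PGL2 F) = rotElt u ∧
      (e.symm (DihedralGroup.sr 0) : PGL2 F) = reflElt α β hαβ := by
  refine exists_mulEquiv_dihedralGroup (orderOf_rotElt h4 s hu) (reflElt_mul_self hαβ)
    (reflElt_mul_rotElt_mul_reflElt hαβ u) ?_
  rintro ⟨k, hk⟩
  exact reflElt_ne_rotElt hαβ h4 (u ^ k) ((rotElt_zpow u k).symm.trans hk).symm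

/-- An element of the dihedral group that fixes a point and lies in `PSL(2, F)` is trivial. -/
theorem eq_one_of_smul_eq_of_mem_PSL2 (h4 : Fintype.card F % 4 = 3) (s : PointLift F)
    {g : PGL2 F} (hg : g ∈ dihedralSubgroup u α β hαβ)
    (hg' : g ∈ PSL2 F) {P : ProjLine F} (hP : g • P = P) : g = 1 := by
  obtain ⟨k, rfl | rfl⟩ := exists_zpow_of_mem_closure_pair (pow_orderOf_eq_one (rotElt u))
    (reflElt_mul_self hαβ) (reflElt_mul_rotElt_mul_reflElt hαβ u) hg
  · rw [rotElt_zpow] at hP ⊢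
    exact rotElt_eq_one_of_smul_eq h4 s hP
  · rw [rotElt_zpow] at hP hg'
    exact absurd hP (reflElt_mul_rotElt_smul_ne hαβ h4 s hg' P)

/-- The rotation by `√-1` and the reflection commute in `PGL(2, F)`, being represented by
anticommuting matrices; hence their images under `DΠ` anticommute. -/
theorem exists_commuting_anticommuting (h4 : Fintype.card F % 4 = 3) (s : PointLift F)
    {lift : PGL2 F → GL (Fin 2) F}
    (hlift : ∀ g, (Matrix.ProjGenLinGroup.mk (lift g) : PGL2 F) = g)
    (hu : ∀ z, z ∈ Subgroup.zpowers u) :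
    ∃ g h : dihedralSubgroup u α β hαβ, g * h = h * g ∧
      doublePaleyRep s lift g * doublePaleyRep s lift h
        = -(doublePaleyRep s lift h * doublePaleyRep s lift g) := by
  obtain ⟨z, hz⟩ := isUnit_quadraticAlgebra h4 (x := (0 : F)) (y := 1) (Or.inr one_ne_zero)
  have hre : z.1.re = 0 := by rw [hz]
  have him : z.1.im = 1 := by rw [hz]
  have hw : rotElt z ∈ dihedralSubgroup u α β hαβ := by
    obtain ⟨k, rfl⟩ := hu z
    rw [← rotElt_zpow]
    exact zpow_mem (Subgroup.subset_closure (by simp)) k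
  have ht : reflElt α β hαβ ∈ dihedralSubgroup u α β hαβ := Subgroup.subset_closure (by simp)
  have hinv : rotElt z * rotElt z = 1 := by
    rw [rotElt, ← map_mul]
    refine mk_eq_one_of_eq_smul_one (-1) ?_
    ext i j
    fin_cases i <;> fin_cases j <;>
      simp [mulMatrix, Matrix.mul_apply, Fin.sum_univ_two, hre, him]
  refine ⟨⟨rotElt z, hw⟩, ⟨reflElt α β hαβ, ht⟩, Subtype.ext ?_, ?_⟩
  · change rotElt z * reflElt α β hαβ = reflElt α β hαβ * rotElt z
    have h1 := reflElt_mul_rotElt_mul_reflElt hαβ z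
    rw [inv_eq_of_mul_eq_one_left hinv, mul_assoc] at h1
    have h2 := reflElt_mul_self hαβ
    calc rotElt z * reflElt α β hαβ
        = reflElt α β hαβ * reflElt α β hαβ * (rotElt z * reflElt α β hαβ) := by
          rw [h2, one_mul]
      _ = _ := by rw [mul_assoc, h1]
  · refine doublePaleyRep_anticommute s hlift h4 ?_ ?_ (reflElt_mem_PSL2 hαβ)
    · ext i j
      fin_cases i <;> fin_cases j <;>
        simp [mulMatrix, Matrix.mul_apply, Fin.sum_univ_two, hre, him,
          Matrix.GeneralLinearGroup.mkOfDetNeZero]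
    · rw [mk_mem_PSL2_iff]
      simp [mulMatrix, Matrix.det_fin_two, hre, him]

end DihedralSubgroup

/-! ### The action on two copies of the projective line -/

section DoubledAction
variable {F : Type*} [Field F]

/-- The action of `PGL(2, F)` on two copies of the projective line, in which the elements outside
`PSL(2, F)` exchange the copies. -/
noncomputable def doubleAct (g : PGL2 F) (j : ProjLine F ⊕ ProjLine F) : ProjLine F ⊕ ProjLine F :=
  open scoped Classical in
  if g ∈ PSL2 F then j.map (g • ·) (g • ·) else (j.map (g • ·) (g • ·)).swap

theorem doubleAct_eq_imp {g h : PGL2 F} {j : ProjLine F ⊕ ProjLine F}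
    (he : doubleAct g j = doubleAct h j) :
    (g ∈ PSL2 F ↔ h ∈ PSL2 F) ∧ ∃ P : ProjLine F, g • P = h • P := by
  unfold doubleAct at he
  by_cases hg : g ∈ PSL2 F <;> by_cases hh : h ∈ PSL2 F <;> rcases j with P | P <;>
    simp [hg, hh] at he ⊢ <;> exact ⟨P, he⟩

variable [Fintype F]

/-- Each `DΠ(g)` is a monomial matrix whose underlying permutation is `doubleAct g`. -/
theorem exists_doublePaleyRep_apply (s : PointLift F) {lift : PGL2 F → GL (Fin 2) F}
    (hlift : ∀ g, (Matrix.ProjGenLinGroup.mk (lift g) : PGL2 F) = g) (g : PGL2 F)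
    (j : ProjLine F ⊕ ProjLine F) :
    ∃ ε : ℂ, ‖ε‖ = 1 ∧ ∀ k, doublePaleyRep s lift g k j = if k = doubleAct g j then ε else 0 := by
  have hn (P : ProjLine F) := norm_qchar (s.lam_ne_zero (lift g) P)
  by_cases hg : g ∈ PSL2 F
  · rw [doublePaleyRep_of_mem s hlift hg]
    rcases j with P | P <;> refine ⟨_, hn P, ?_⟩ <;> rintro (R | R) <;>
      simp [doubleAct, hg, paleyMono, hlift]
  · rw [doublePaleyRep_of_notMem s hlift hg]
    rcases j with P | P
    · refine ⟨_, hn P, ?_⟩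
      rintro (R | R) <;> simp [doubleAct, hg, paleyMono, hlift]
    · refine ⟨-qchar (s.lam (lift g) P), by rw [norm_neg, hn], ?_⟩
      rintro (R | R)
      · simp only [doubleAct, hg, paleyMono, hlift, if_false, Sum.map_inr, Sum.swap_inr,
          Matrix.fromBlocks_apply₁₂, Matrix.neg_apply, Matrix.of_apply, Sum.inl.injEq]
        split_ifs <;> simp
      · simp [doubleAct, hg]

/-- The dihedral group acts simply transitively on the two copies of the projective line: the
stabilizers are trivial, and both sides have `2(q+1)` elements. -/
theorem bijective_doubleAct {u : (QuadraticAlgebra F (-1) 0)ˣ} {α β : F}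
    (hαβ : α ^ 2 + β ^ 2 = -1) (h4 : Fintype.card F % 4 = 3) (s : PointLift F)
    (hu : ∀ z, z ∈ Subgroup.zpowers u) (j : ProjLine F ⊕ ProjLine F) :
    Function.Bijective fun g : dihedralSubgroup u α β hαβ => doubleAct (g : PGL2 F) j := by
  obtain ⟨e, -⟩ := exists_dihedralSubgroup_mulEquiv hαβ h4 s hu
  have hcard : Nat.card (dihedralSubgroup u α β hαβ) = Nat.card (ProjLine F ⊕ ProjLine F) := by
    rw [Nat.card_congr e.toEquiv, DihedralGroup.nat_card, Nat.card_sum, Nat.card_eq_fintype_card,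
      card_projLine, two_mul]
  refine (Nat.bijective_iff_injective_and_card _).2 ⟨fun g h hgh => ?_, hcard⟩
  obtain ⟨hmem, P, hP⟩ := doubleAct_eq_imp hgh
  have h1 : (h : PGL2 F)⁻¹ * g = 1 := by
    refine eq_one_of_smul_eq_of_mem_PSL2 hαβ h4 s (mul_mem (inv_mem h.2) g.2) ?_ (P := P) ?_
    · rw [mul_mem_PSL2_iff, inv_mem_iff]; exact hmem.symm
    · rw [mul_smul, hP, inv_smul_smul]
  exact Subtype.ext (inv_mul_eq_one.1 h1).symm

end DoubledAction

/-! ### Double Paley frames -/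

section DoublePaleyFrames
variable {F : Type*} [Field F] [Fintype F] (s : PointLift F)

/-- Multiplying the second half of the vectors by `√-1` turns the Gram matrix of a double Paley
frame into the matrix attached to the skew Hadamard matrix. -/
theorem exists_rephase_skewGram {m : Type*} [Fintype m]
    {Ψ : Matrix m (ProjLine F ⊕ ProjLine F) ℂ} (h : Ψᴴ * Ψ = blockGram (doublePaley s)) :
    ∃ (e : ProjLine F ⊕ ProjLine F → ℂ), (∀ j, ‖e j‖ = 1) ∧
      (Matrix.of fun i j => e j * Ψ i j)ᴴ * (Matrix.of fun i j => e j * Ψ i j)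
        = skewGram (doublePaley s) := by
  classical
  let e : ProjLine F ⊕ ProjLine F → ℂ := Sum.elim (fun _ => 1) fun _ => Complex.I
  refine ⟨e, by rintro (j | j) <;> simp [e], ?_⟩
  have hgram (j k) : ((Matrix.of fun i j => e j * Ψ i j)ᴴ * (Matrix.of fun i j => e j * Ψ i j)) j k
      = star (e j) * e k * blockGram (doublePaley s) j k := by
    rw [← h]
    exact gram_apply_of_switching (Φ := Ψ) (σ := id) (one_mem _) (fun i j => by simp) j k
  have hN : (Fintype.card (ProjLine F ⊕ ProjLine F) : ℝ) - 1
      = 2 * (Fintype.card (ProjLine F) : ℝ) - 1 := by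
    rw [Fintype.card_sum]; push_cast; ring
  ext j k
  rw [hgram, skewGram, hN, blockGram]
  rcases j with P | P <;> rcases k with R | R
  · simp [e, doublePaley, doubling, Matrix.one_apply]
    ring
  · simp [e, doublePaley, doubling]
    ring
  · simp [e, doublePaley, doubling]
    ring
  · simp [e, doublePaley, doubling, Matrix.one_apply]
    ring

theorem exists_isDoublePaleyConfig (h4 : Fintype.card F % 4 = 3) :
    ∃ Φ : Matrix (Fin (Fintype.card F + 1)) (Fin (2 * Fintype.card F + 2)) ℂ,
      IsDoublePaleyConfig s Φ := by
  obtain ⟨Ψ, hΨ⟩ := exists_frame_blockGram s h4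
  let e₁ : ProjLine F ≃ Fin (Fintype.card F + 1) := Fintype.equivFinOfCardEq card_projLine
  let e₂ : ProjLine F ⊕ ProjLine F ≃ Fin (2 * Fintype.card F + 2) :=
    Fintype.equivFinOfCardEq (by rw [Fintype.card_sum, card_projLine]; ring)
  refine ⟨Ψ.submatrix e₁.symm e₂.symm, Ψ.submatrix e₁.symm id, ?_, 1, e₂, fun _ => 1, one_mem _,
    by simp, by simp⟩
  rw [Matrix.conjTranspose_submatrix, Matrix.submatrix_mul_equiv, hΨ, Matrix.submatrix_id_id]

end DoublePaleyFrames

/-! ### Double Paley frames are genuinely projective dihedral frames -/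

theorem mainTheorem10 {F : Type*} [Field F] [Fintype F] (q : ℕ) (hq : Fintype.card F = q)
    (hq4 : q % 4 = 3) (s : PointLift F)
    (lift : PGL2 F → Matrix.GeneralLinearGroup (Fin 2) F)
    (hlift : ∀ g, (Matrix.ProjGenLinGroup.mk (lift g) : PGL2 F) = g)
    (u : (QuadraticAlgebra F (-1) 0)ˣ) (hu : ∀ z, z ∈ Subgroup.zpowers u)
    (α β : F) (hαβ : α ^ 2 + β ^ 2 = -1) :
    -- the subgroup is dihedral of order `2(q+1)`, with the expected rotation and reflection
    Nat.card (dihedralSubgroup u α β hαβ) = 2 * (q + 1) ∧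
    (∃ e : dihedralSubgroup u α β hαβ ≃* DihedralGroup (q + 1),
      (e.symm (DihedralGroup.r 1) : PGL2 F) = rotElt u ∧
      (e.symm (DihedralGroup.sr 0) : PGL2 F) = reflElt α β hαβ) ∧
    -- `DΠ` is a projective representation, and its restriction is genuinely projective
    IsProjUnitaryRep (doublePaleyRep s lift) ∧
    IsGenuineProjRep (fun g : dihedralSubgroup u α β hαβ => doublePaleyRep s lift g) ∧
    -- the double Paley matrix is skew Hadamard, and the double Paley frame exists
    IsSkewHadamard (doublePaley s) ∧
    (∃ Φ : Matrix (Fin (q + 1)) (Fin (2 * q + 2)) ℂ, IsDoublePaleyConfig s Φ) ∧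
    -- every double Paley frame is an ETF and a genuinely projective dihedral frame through `DΠ`
    ∀ Φ : Matrix (Fin (q + 1)) (Fin (2 * q + 2)) ℂ, IsDoublePaleyConfig s Φ →
      IsETF Φ ∧
      ∃ (Φ₀ : Matrix (Fin (q + 1)) (ProjLine F ⊕ ProjLine F) ℂ)
        (π : dihedralSubgroup u α β hαβ → Matrix (Fin (q + 1)) (Fin (q + 1)) ℂ),
        SwitchingEquiv Φ Φ₀ ∧ Φ₀ᴴ * Φ₀ = skewGram (doublePaley s) ∧
        IsGenuineProjRep π ∧
        (∀ g, π g * Φ₀ * (doublePaleyRep s lift g)ᴴ = Φ₀) ∧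
        ∀ (j : ProjLine F ⊕ ProjLine F) (v : Fin (q + 1) → ℂ), v = (fun i => Φ₀ i j) →
          HasUnitColumns (groupConfig π v) ∧ IsReducedConfig (groupConfig π v) ∧
          SwitchingEquiv Φ (groupConfig π v) := by
  subst hq
  have hskew := isSkewHadamard_doublePaley s hq4
  have hcardSum : Fintype.card (ProjLine F ⊕ ProjLine F) = 2 * (Fintype.card F + 1) := by
    rw [Fintype.card_sum, card_projLine, two_mul]
  have hlt : 1 / √((Fintype.card (ProjLine F ⊕ ProjLine F) : ℝ) - 1) < 1 := by
    have : (0 : ℝ) < Fintype.card F := by exact_mod_cast Fintype.card_pos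
    rw [hcardSum, div_lt_one (Real.sqrt_pos.2 (by push_cast; linarith)), Real.lt_sqrt (by norm_num)]
    push_cast; linarith
  obtain ⟨e, he⟩ := exists_dihedralSubgroup_mulEquiv hαβ hq4 s hu
  have hproj := isProjUnitaryRep_doublePaleyRep s hlift
  have hprojΔ : IsProjUnitaryRep fun g : dihedralSubgroup u α β hαβ => doublePaleyRep s lift g :=
    ⟨fun g => hproj.1 g, fun g h => hproj.2 g h⟩
  obtain ⟨w, t, hwt, hanti⟩ := exists_commuting_anticommuting hαβ hq4 s hlift hu
  have : Nonempty (ProjLine F ⊕ ProjLine F) := Fintype.card_pos_iff.1 (by rw [hcardSum]; positivity)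
  refine ⟨by rw [Nat.card_congr e.toEquiv, DihedralGroup.nat_card], ⟨e, he⟩, hproj,
    isGenuineProjRep_of_anticommute hprojΔ hwt hanti, hskew, exists_isDoublePaleyConfig s hq4,
    ?_⟩
  rintro Φ ⟨Ψ, hΨ, hΦΨ⟩
  obtain ⟨p, hp, hgram⟩ := exists_rephase_skewGram s hΨ
  set Φ₀ : Matrix (Fin (Fintype.card F + 1)) (ProjLine F ⊕ ProjLine F) ℂ :=
    Matrix.of fun i j => p j * Ψ i j with hΦ₀
  have hsw : SwitchingEquiv Φ Φ₀ := hΦΨ.trans_monomial (Equiv.refl _) p hp fun i j => rfl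
  have hdiag (j) : (Φ₀ᴴ * Φ₀) j j = 1 := by rw [hgram, hskew.skewGram_apply_self]
  have hoff (j k) (hjk : j ≠ k) : ‖(Φ₀ᴴ * Φ₀) j k‖
      = 1 / √((Fintype.card (ProjLine F ⊕ ProjLine F) : ℝ) - 1) := by
    rw [hgram, hskew.norm_skewGram_apply hjk]
  have hframe : Φ₀ * Φ₀ᴴ = (2 : ℂ) • 1 := by
    refine mul_conjTranspose_eq_two hgram (hskew.skewGram_mul_self (by rw [hcardSum]; omega)) ?_
    rw [hskew.trace_skewGram, hcardSum, Fintype.card_fin]; push_cast; ring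
  refine ⟨hsw.symm.isETF hframe hdiag hoff, ?_⟩
  have hc (g : dihedralSubgroup u α β hαβ) :
      doublePaleyRep s lift g * (Φ₀ᴴ * Φ₀) = Φ₀ᴴ * Φ₀ * doublePaleyRep s lift g := by
    rw [hgram]
    exact skewGram_commute (doublePaleyRep_mul_doublePaley s hlift hq4 g)
  have hint (g : dihedralSubgroup u α β hαβ) :
      compression Φ₀ (doublePaleyRep s lift g) * Φ₀ = Φ₀ * doublePaleyRep s lift g :=
    compression_mul_frame hframe (hc g)
  refine ⟨Φ₀, fun g => compression Φ₀ (doublePaleyRep s lift g), hsw, hgram, ?_, ?_, ?_⟩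
  · refine isGenuineProjRep_of_anticommute (isProjUnitaryRep_compression hframe hprojΔ hc) hwt ?_
    rw [compression_mul hframe (hc w), compression_mul hframe (hc t), hanti]
    simp [compression]
  · intro g
    rw [hint, Matrix.mul_assoc]
    have := Matrix.mem_unitaryGroup_iff.1 (hproj.1 g)
    rw [Matrix.star_eq_conjTranspose] at this
    rw [this, Matrix.mul_one]
  · rintro j v rfl
    choose ε hε hεk using fun g : dihedralSubgroup u α β hαβ =>
      exists_doublePaleyRep_apply s hlift g j
    -- the vectors of the orbit are, up to signs, the vectors of `Φ₀`, each occurring once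
    let τ := Equiv.ofBijective _ (bijective_doubleAct hαβ hq4 s hu j)
    have hcol (i : Fin (Fintype.card F + 1)) (g : dihedralSubgroup u α β hαβ) :
        groupConfig (fun g : dihedralSubgroup u α β hαβ => compression Φ₀ (doublePaleyRep s lift g))
          (fun i => Φ₀ i j) i g = ε g * Φ₀ i (τ g) := by
      have h1 := congrFun (congrFun (hint g) i) j
      change (compression Φ₀ (doublePaleyRep s lift g) * Φ₀) i j = _
      rw [h1, Matrix.mul_apply]
      simp only [hεk, mul_ite, mul_zero]
      rw [Finset.sum_ite_eq', if_pos (Finset.mem_univ _), mul_comm]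
      rfl
    have hcol' (i) (g) := (hcol i g).trans (by rw [← Matrix.one_mul Φ₀])
    refine ⟨hasUnitColumns_iff.2 (gram_apply_self_of_switching (one_mem _) hε hcol' hdiag),
      isReducedConfig_of_norm_lt (gram_apply_self_of_switching (one_mem _) hε hcol' hdiag)
        fun g h hgh => ?_, ?_⟩
    · rw [norm_gram_apply_of_switching (one_mem _) hε hcol', hoff _ _ (τ.injective.ne hgh)]
      exact hlt
    · exact hsw.trans_monomial τ ε hε hcol
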